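/- Let $n\ge 0$ be an integer; all Hilbert spaces are complex. Let $\Gamma$ be the full Fock space over $\mathbb C^n$, with orthonormal basis $\{e_\alpha\}$ indexed by the words $\alpha$ in the letters $1,\dots,n$, and let $L_je_\alpha=e_{j\alpha}$ and $R_je_\alpha=e_{\alpha j}$ be the left and right creation operators. Let $\mathcal F_n^\infty\subseteq\mathcal B(\Gamma)$ be the WOT-closed algebra generated by $I,L_1,\dots,L_n$. Let $\mathcal P_J$ be a set of noncommutative polynomials in $n$ variables (identified with their values at $(L_1,\dots,L_n)$), let $J$ be the WOT-closed two-sided ideal of $\mathcal F_n^\infty$ generated by $\mathcal P_J$, and assume $J\ne\mathcal F_n^\infty$. Put $\mathcal M_J=\overline{\mathrm{span}}\{\phi\psi:\phi\in J,\ \psi\in\Gamma\}$ and $\mathcal N=\Gamma\ominus\mathcal M_J$. An $n$-tuple $T=(T_1,\dots,T_n)$ of bounded operators on a Hilbert space $\mathcal H$ is a row contraction if the row operator $T:\mathcal H^n\to\mathcal H$, $T(h_1,\dots,h_n)=\sum_i T_ih_i$, is a contraction; it is a $J$-constrained row contraction if moreover $p(T_1,\dots,T_n)=0$ for all $p\in\mathcal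 P_J$. For a row contraction $T$ let $D_T=(I-T^*T)^{1/2}$, $D_{T^*}=(I-TT^*)^{1/2}$, $\mathcal D_T=\overline{\mathrm{ran}}\,D_T\subseteq\mathcal H^n$ and $\mathcal D_{T^*}=\overline{\mathrm{ran}}\,D_{T^*}\subseteq\mathcal H$. Let $P_j:\mathcal H^n\to\mathcal H$ be the $j$-th coordinate map. The characteristic function of $T$ is the operator $\Theta_T:\Gamma\otimes\mathcal D_T\to\Gamma\otimes\mathcal D_{T^*}$ given by the strong operator limit $$\Theta_T=\lim_{r\to1^-}\Big[-I\otimes T|_{\mathcal D_T}+(I\otimes D_{T^*})\Big(I-r\sum_{j}R_j\otimes T_j^*\Big)^{-1}r\sum_{j}R_j\otimes P_jD_T|_{\mathcal D_T}\Big],$$ and the constrained characteristic function is $\Theta_{J,T}=P_{\mathcal N\otimes\mathcal D_{T^*}}\Theta_T|_{\mathcal N\otimes\mathcal D_T}$. Operators $\Theta:\mathcal N\otimes\mathcal E\to\mathcal N\otimes\mathcal E_*$ and $\Theta':\mathcal N\otimes\mathcal E'\to\mathcal N\otimes\mathcal E_*'$ are said to coincide if there are unitary operators $W:\mathcal E\to\mathcal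 E'$ and $W_*:\mathcal E_*\to\mathcal E_*'$ such that $(I_{\mathcal N}\otimes W_*)\Theta=\Theta'(I_{\mathcal N}\otimes W)$. **Theorem.** Let $\mathcal H=\mathcal H_1\oplus\mathcal H_0\oplus\mathcal H_{-1}$ be an orthogonal direct sum of Hilbert spaces and let $T=(T_1,\dots,T_n)$ be a $J$-constrained row contraction on $\mathcal H$ with $$T_i=\begin{bmatrix}S_i&*&*\\0&N_i&*\\0&0&C_i\end{bmatrix}\qquad(i=1,\dots,n).$$ Then $S$, $N$ and $C$ are $J$-constrained row contractions on $\mathcal H_1$, $\mathcal H_0$ and $\mathcal H_{-1}$, respectively, and there exist Hilbert spaces $\mathcal E_1,\mathcal E_2,\mathcal E$ and unitary operators $\tau_1:\mathcal D_{N^*}\oplus\mathcal E\to\mathcal D_C\oplus\mathcal E_1$ and $\tau_2:\mathcal D_{S^*}\oplus\mathcal E_2\to\mathcal D_N\oplus\mathcal E$ such that $\Theta_{J,T}$ coincides with $$\begin{bmatrix}\Theta_{J,C}&0\\0&I_{\mathcal N\otimes\mathcal E_1}\end{bmatrix}(I_{\mathcal N}\otimes\tau_1)\begin{bmatrix}\Theta_{J,N}&0\\0&I_{\mathcal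 N\otimes\mathcal E}\end{bmatrix}(I_{\mathcal N}\otimes\tau_2)\begin{bmatrix}\Theta_{J,S}&0\\0&I_{\mathcal N\otimes\mathcal E_2}\end{bmatrix}.$$ -/

import Mathlib

open Filter Topology
open scoped InnerProductSpace

noncomputable section

namespace NCVariety

section Rows

variable {n : ℕ} {H : Type*} [NormedAddCommGroup H] [InnerProductSpace ℂ H] [CompleteSpace H]
  {K : Type*} [NormedAddCommGroup K] [InnerProductSpace ℂ K] [CompleteSpace K]

/-- The row operator `(h_1, …, h_n) ↦ ∑ T_i h_i` from the Hilbert space `H^n` to `H`. -/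
def rowOp (T : Fin n → H →L[ℂ] H) : PiLp 2 (fun _ : Fin n => H) →L[ℂ] H :=
  ∑ i, T i ∘L PiLp.proj 2 (fun _ : Fin n => H) i

/-- `T` is a row contraction: its row operator is a contraction. -/
def IsRowContraction (T : Fin n → H →L[ℂ] H) : Prop := ‖rowOp T‖ ≤ 1

/-- The defect operator `(I - A* A)^{1/2}` of a contraction `A`. -/
def defectOp (A : H →L[ℂ] K) : H →L[ℂ] H :=
  CFC.sqrt (1 - ContinuousLinearMap.adjoint A ∘L A)

/-- The defect space of `A`: the closure of the range of the defect operator. -/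
def defectSpace (A : H →L[ℂ] K) : Submodule ℂ H :=
  (LinearMap.range (defectOp A).toLinearMap).topologicalClosure

instance (A : H →L[ℂ] K) : CompleteSpace (defectSpace A) :=
  inferInstanceAs (CompleteSpace
    (LinearMap.range (defectOp A).toLinearMap).topologicalClosure)

/-- The defect operator with values in the defect space. -/
def defectOpOnto (A : H →L[ℂ] K) : H →L[ℂ] defectSpace A :=
  (defectOp A).codRestrict (defectSpace A)
    (fun x => Submodule.le_topologicalClosure _ ⟨x, rfl⟩)

/-- The defect space `𝒟_T ⊆ H^n` of the tuple `T`. -/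
abbrev DSpace (T : Fin n → H →L[ℂ] H) : Submodule ℂ (PiLp 2 (fun _ : Fin n => H)) :=
  defectSpace (rowOp T)

/-- The defect space `𝒟_{T*} ⊆ H` of the tuple `T`. -/
abbrev DStarSpace (T : Fin n → H →L[ℂ] H) : Submodule ℂ H :=
  defectSpace (ContinuousLinearMap.adjoint (rowOp T))

end Rows

section DefectFacts

variable {E : Type*} [NormedAddCommGroup E] [InnerProductSpace ℂ E] [CompleteSpace E]
  {F : Type*} [NormedAddCommGroup F] [InnerProductSpace ℂ F] [CompleteSpace F]

theorem defect_pos (A : E →L[ℂ] F) (hA : ‖A‖ ≤ 1) :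
    0 ≤ 1 - ContinuousLinearMap.adjoint A ∘L A := by
  rw [ContinuousLinearMap.nonneg_iff_isPositive, ContinuousLinearMap.isPositive_iff_complex]
  intro x
  have h1 : ⟪(1 - ContinuousLinearMap.adjoint A ∘L A) x, x⟫_ℂ
      = (((‖x‖ ^ 2 - ‖A x‖ ^ 2 : ℝ)) : ℂ) := by
    simp [ContinuousLinearMap.adjoint_inner_left, inner_self_eq_norm_sq_to_K]
  have h2 : ‖A x‖ ≤ ‖x‖ := by
    simpa using A.le_of_opNorm_le hA x
  rw [h1]
  refine ⟨rfl, ?_⟩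
  change 0 ≤ ‖x‖ ^ 2 - ‖A x‖ ^ 2
  nlinarith [norm_nonneg (A x)]

theorem defect_nonneg (A : E →L[ℂ] F) : 0 ≤ defectOp A := CFC.sqrt_nonneg _

theorem defect_sq (A : E →L[ℂ] F) (hA : ‖A‖ ≤ 1) (x : E) :
    defectOp A (defectOp A x) = x - ContinuousLinearMap.adjoint A (A x) := by
  have h := CFC.sqrt_mul_sqrt_self (1 - ContinuousLinearMap.adjoint A ∘L A) (defect_pos A hA)
  exact congrArg (fun B : E →L[ℂ] E => B x) h

theorem defect_symm (A : E →L[ℂ] F) (x y : E) :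
    ⟪defectOp A x, y⟫_ℂ = ⟪x, defectOp A y⟫_ℂ :=
  ((ContinuousLinearMap.nonneg_iff_isPositive _).1 (defect_nonneg A)).inner_left_eq_inner_right x y

theorem defect_norm (A : E →L[ℂ] F) (hA : ‖A‖ ≤ 1) (x : E) :
    ‖defectOp A x‖ ^ 2 + ‖A x‖ ^ 2 = ‖x‖ ^ 2 := by
  have h : ⟪defectOp A x, defectOp A x⟫_ℂ + ⟪A x, A x⟫_ℂ = ⟪x, x⟫_ℂ := by
    rw [defect_symm, defect_sq A hA, inner_sub_right, ContinuousLinearMap.adjoint_inner_right]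
    ring
  simp only [inner_self_eq_norm_sq_to_K] at h
  exact_mod_cast h

theorem commute_of_commute_sq {G : Type*} [NormedAddCommGroup G] [InnerProductSpace ℂ G]
    [CompleteSpace G] (B K : G →L[ℂ] G) (hB : 0 ≤ B) (hc : Commute (B * B) K) : Commute B K := by
  have hs : CFC.sqrt (B * B) = B := CFC.sqrt_unique rfl hB
  rw [← hs]
  exact hc.cfcₙ_nnreal _

theorem defect_intertwine (A : E →L[ℂ] F) (hA : ‖A‖ ≤ 1) (x : E) :
    A (defectOp A x) = defectOp (ContinuousLinearMap.adjoint A) (A x) := by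
  have hA' : ‖ContinuousLinearMap.adjoint A‖ ≤ 1 := by simpa using hA
  let e := WithLp.prodContinuousLinearEquiv 2 ℂ E F
  let B : WithLp 2 (E × F) →L[ℂ] WithLp 2 (E × F) := e.symm.toContinuousLinearMap ∘L
    ((defectOp A).prodMap (defectOp (ContinuousLinearMap.adjoint A))) ∘L e.toContinuousLinearMap
  let K : WithLp 2 (E × F) →L[ℂ] WithLp 2 (E × F) := e.symm.toContinuousLinearMap ∘L
    (ContinuousLinearMap.inr ℂ E F ∘L A ∘L ContinuousLinearMap.fst ℂ E F) ∘L
      e.toContinuousLinearMap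
  have hBx : ∀ z, B z = WithLp.toLp 2 (defectOp A z.fst,
    defectOp (ContinuousLinearMap.adjoint A) z.snd) := fun z => rfl
  have hKx : ∀ z, K z = WithLp.toLp 2 ((0 : E), A z.fst) := fun z => rfl
  have hB : 0 ≤ B := by
    rw [ContinuousLinearMap.nonneg_iff_isPositive]
    have p1 := (ContinuousLinearMap.nonneg_iff_isPositive _).1 (defect_nonneg A)
    have p2 := (ContinuousLinearMap.nonneg_iff_isPositive _).1
      (defect_nonneg (ContinuousLinearMap.adjoint A))
    refine (ContinuousLinearMap.isPositive_iff _).2 ?_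
    refine ⟨fun y z => ?_, fun z => ?_⟩
    · change ⟪B y, z⟫_ℂ = ⟪y, B z⟫_ℂ
      rw [hBx, hBx, WithLp.prod_inner_apply, WithLp.prod_inner_apply]
      exact congrArg₂ (· + ·) (defect_symm _ _ _) (defect_symm _ _ _)
    · rw [hBx, WithLp.prod_inner_apply]
      open scoped ComplexOrder in
      exact add_nonneg (p1.inner_nonneg_left _) (p2.inner_nonneg_left _)
  have hc : Commute (B * B) K := by
    refine ContinuousLinearMap.ext fun z => ?_
    change B (B (K z)) = K (B (B z))
    have e1 := defect_sq (ContinuousLinearMap.adjoint A) hA' (A z.fst)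
    have e2 := congrArg A (defect_sq A hA z.fst)
    rw [ContinuousLinearMap.adjoint_adjoint] at e1
    rw [map_sub] at e2
    rw [hKx, hKx, hBx, hBx, hBx, hBx]
    change WithLp.toLp 2 (defectOp A (defectOp A 0), defectOp (ContinuousLinearMap.adjoint A)
      (defectOp (ContinuousLinearMap.adjoint A) (A z.fst))) =
      WithLp.toLp 2 ((0 : E), A (defectOp A (defectOp A z.fst)))
    rw [e1, e2, map_zero, map_zero]
  have hc' : Commute B K := commute_of_commute_sq B K hB hc
  have h := congrArg (fun M : WithLp 2 (E × F) →L[ℂ] WithLp 2 (E × F) =>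
    (M (WithLp.toLp 2 (x, (0 : F)))).snd) hc'.eq
  change (B (K _)).snd = (K (B _)).snd at h
  simpa [hBx, hKx] using h.symm

/-- The identity expressing that the Julia operator of a contraction is isometric. -/
theorem julia_norm (A : E →L[ℂ] F) (hA : ‖A‖ ≤ 1) (h : F) (f : E) :
    ‖ContinuousLinearMap.adjoint A h + defectOp A f‖ ^ 2 +
      ‖defectOp (ContinuousLinearMap.adjoint A) h - A f‖ ^ 2 = ‖h‖ ^ 2 + ‖f‖ ^ 2 := by
  have hA' : ‖ContinuousLinearMap.adjoint A‖ ≤ 1 := by simpa using hA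
  have h1 := defect_norm A hA f
  have h2 := defect_norm _ hA' h
  have h3 : ⟪ContinuousLinearMap.adjoint A h, defectOp A f⟫_ℂ =
      ⟪defectOp (ContinuousLinearMap.adjoint A) h, A f⟫_ℂ := by
    rw [ContinuousLinearMap.adjoint_inner_left, defect_intertwine A hA, defect_symm]
  rw [norm_add_sq (𝕜 := ℂ), norm_sub_sq (𝕜 := ℂ), h3]
  linarith

end DefectFacts

section Fock

variable (n : ℕ) (E : Type*) [NormedAddCommGroup E] [InnerProductSpace ℂ E]

/-- The Hilbert space `Γ ⊗ E`, where `Γ` is the full Fock space over `ℂ^n`, realised as the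
square-summable `E`-valued families indexed by the free monoid on `n` letters:
the family `f` stands for `∑_α e_α ⊗ f(α)`. -/
abbrev FockTensor : Type _ := lp (fun _ : FreeMonoid (Fin n) => E) 2

/-- The full Fock space `Γ` over `ℂ^n`, with orthonormal basis `e_α` (`α` a word). -/
abbrev Fock : Type := FockTensor n ℂ

variable {n E}
variable {F : Type*} [NormedAddCommGroup F] [InnerProductSpace ℂ F]

theorem memlp_two_iff {ι E : Type*} [NormedAddCommGroup E] (f : ι → E) :
    Memℓp f 2 ↔ Summable fun i => ‖f i‖ ^ 2 := by
  rw [memℓp_gen_iff (by norm_num)]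
  simp

theorem fock_norm_sq {ι E : Type*} [NormedAddCommGroup E] (f : lp (fun _ : ι => E) 2) : ‖f‖ ^ 2 = ∑' i, ‖f i‖ ^ 2 := by
  have h := lp.norm_rpow_eq_tsum (p := 2) (by norm_num) f
  simpa using h

theorem fock_summable {ι E : Type*} [NormedAddCommGroup E] (f : lp (fun _ : ι => E) 2) : Summable fun i => ‖f i‖ ^ 2 :=
  (memlp_two_iff _).1 (lp.memℓp f)

/-- The elementary tensor `x ⊗ η`. -/
def elem (x : Fock n) (η : E) : FockTensor n E :=
  ⟨fun w => x w • η, (memlp_two_iff _).2 (by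
    simp_rw [norm_smul, mul_pow]
    exact (fock_summable x).mul_right _)⟩

@[simp] theorem elem_apply (x : Fock n) (η : E) (w : FreeMonoid (Fin n)) :
    elem x η w = x w • η := rfl

theorem inner_elem (x y : Fock n) (η ξ : E) :
    ⟪elem x η, elem y ξ⟫_ℂ = ⟪x, y⟫_ℂ * ⟪η, ξ⟫_ℂ := by
  simp only [lp.inner_eq_tsum, elem_apply, inner_smul_left, inner_smul_right]
  rw [← tsum_mul_right]
  refine tsum_congr fun w => ?_
  simp only [RCLike.inner_apply]
  ring

/-- The operator `I_Γ ⊗ A`. -/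
def idTensor (A : E →L[ℂ] F) : FockTensor n E →L[ℂ] FockTensor n F :=
  LinearMap.mkContinuous
    { toFun := fun f => ⟨fun w => A (f w), (memlp_two_iff _).2 (by
        refine Summable.of_nonneg_of_le (fun _ => by positivity) (fun w => ?_)
          ((fock_summable f).mul_left (‖A‖ ^ 2))
        rw [← mul_pow]
        exact pow_le_pow_left₀ (norm_nonneg _) (A.le_opNorm _) 2)⟩
      map_add' := fun f g => by ext w; exact A.map_add _ _
      map_smul' := fun c f => by ext w; simp } ‖A‖ (fun f => by
    refine le_of_sq_le_sq ?_ (by positivity)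
    rw [mul_pow, fock_norm_sq, fock_norm_sq, ← tsum_mul_left]
    refine Summable.tsum_le_tsum (fun w => ?_) (fock_summable _) ((fock_summable f).mul_left _)
    rw [← mul_pow]
    exact pow_le_pow_left₀ (norm_nonneg _) (A.le_opNorm _) 2)

@[simp] theorem idTensor_apply (A : E →L[ℂ] F) (f : FockTensor n E) (w : FreeMonoid (Fin n)) :
    idTensor A f w = A (f w) := rfl

@[simp] theorem idTensor_elem (A : E →L[ℂ] F) (x : Fock n) (η : E) :
    idTensor A (elem x η) = elem x (A η) := by
  ext w; simp

/-- Transport of families along an injective map of words: `∑ e_α ⊗ f(α) ↦ ∑ e_{g α} ⊗ f(α)`. -/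
def push (g : FreeMonoid (Fin n) → FreeMonoid (Fin n)) (hg : Function.Injective g) :
    FockTensor n E →L[ℂ] FockTensor n E :=
  LinearMap.mkContinuous
    { toFun := fun f => ⟨Function.extend g (fun w => f w) 0, (memlp_two_iff _).2 (by
        have : (fun w => ‖Function.extend g (fun w => f w) 0 w‖ ^ 2)
            = Function.extend g (fun w => ‖f w‖ ^ 2) 0 := by
          funext w
          by_cases h : ∃ v, g v = w
          · obtain ⟨v, rfl⟩ := h
            simp [hg.extend_apply]
          · simp [Function.extend_apply' _ _ _ h]
        rw [this]
        exact (summable_extend_zero hg).2 (fock_summable f))⟩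
      map_add' := fun f f' => by
        ext w
        change Function.extend g (fun w => f w + f' w) 0 w =
          Function.extend g (fun w => f w) 0 w + Function.extend g (fun w => f' w) 0 w
        by_cases h : ∃ v, g v = w
        · obtain ⟨v, rfl⟩ := h
          simp [hg.extend_apply]
        · simp [Function.extend_apply' _ _ _ h]
      map_smul' := fun c f => by
        ext w
        by_cases h : ∃ v, g v = w
        · obtain ⟨v, rfl⟩ := h
          simp [hg.extend_apply]
        · simp [Function.extend_apply' _ _ _ h] } 1 (fun f => by
    refine le_of_sq_le_sq ?_ (by positivity)
    rw [one_mul, fock_norm_sq, fock_norm_sq]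
    have : (fun w => ‖Function.extend g (fun w => f w) 0 w‖ ^ 2)
        = Function.extend g (fun w => ‖f w‖ ^ 2) 0 := by
      funext w
      by_cases h : ∃ v, g v = w
      · obtain ⟨v, rfl⟩ := h
        simp [hg.extend_apply]
      · simp [Function.extend_apply' _ _ _ h]
    exact le_of_eq ((congrArg tsum this).trans (tsum_extend_zero hg _)))

/-- The left creation operator `L_j` (for `E = ℂ`), and `L_j ⊗ I_E` in general:
`e_α ⊗ η ↦ e_{jα} ⊗ η`. -/
def leftCreation (j : Fin n) : FockTensor n E →L[ℂ] FockTensor n E :=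
  push (fun w => FreeMonoid.of j * w) (mul_right_injective _)

/-- The right creation operator `R_j` (for `E = ℂ`), and `R_j ⊗ I_E` in general:
`e_α ⊗ η ↦ e_{αj} ⊗ η`. -/
def rightCreation (j : Fin n) : FockTensor n E →L[ℂ] FockTensor n E :=
  push (fun w => w * FreeMonoid.of j) (mul_left_injective _)


@[simp] theorem rightCreation_apply_mul (j : Fin n) (f : FockTensor n E)
    (w : FreeMonoid (Fin n)) : rightCreation j f (w * FreeMonoid.of j) = f w :=
  (mul_left_injective (FreeMonoid.of j)).extend_apply _ _ w

theorem rightCreation_elem (j : Fin n) (x : Fock n) (η : E) :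
    rightCreation j (elem x η) = elem (rightCreation j x) η := by
  ext w
  change Function.extend (fun v => v * FreeMonoid.of j) (fun w => x w • η) 0 w =
    (Function.extend (fun v => v * FreeMonoid.of j) (fun w => x w) 0 w : ℂ) • η
  by_cases h : ∃ v, v * FreeMonoid.of j = w
  · obtain ⟨v, rfl⟩ := h
    simp [(mul_left_injective (FreeMonoid.of j)).extend_apply]
  · simp [Function.extend_apply' _ _ _ h]

end Fock

section CharFun

variable {n : ℕ} {H : Type*} [NormedAddCommGroup H] [InnerProductSpace ℂ H] [CompleteSpace H]

/-- The operator `R̃ T̃* = ∑ R_j ⊗ T_j*` on `Γ ⊗ H`. -/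
def creationAdj (T : Fin n → H →L[ℂ] H) : FockTensor n H →L[ℂ] FockTensor n H :=
  ∑ j, rightCreation j ∘L idTensor (ContinuousLinearMap.adjoint (T j))

/-- The operator `R̃ (I ⊗ D_T) = ∑ R_j ⊗ P_j D_T` from `Γ ⊗ 𝒟_T` to `Γ ⊗ H`. -/
def creationDefect (T : Fin n → H →L[ℂ] H) :
    FockTensor n (DSpace T) →L[ℂ] FockTensor n H :=
  ∑ j, rightCreation j ∘L idTensor
    (PiLp.proj 2 (fun _ : Fin n => H) j ∘L defectOp (rowOp T) ∘L (DSpace T).subtypeL)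

/-- The restriction `T|_{𝒟_T} : 𝒟_T → 𝒟_{T*}` of the row operator. (As `T D_T = D_{T*} T`, the row
operator maps `𝒟_T` into `𝒟_{T*}`; the projection only adjusts the codomain.) -/
def rowOpDefect (T : Fin n → H →L[ℂ] H) : DSpace T →L[ℂ] DStarSpace T :=
  (DStarSpace T).orthogonalProjectionOnto ∘L rowOp T ∘L (DSpace T).subtypeL

/-- `Θ_T(r R̃) = -T̃ + D_{T̃*} (I - r R̃ T̃*)⁻¹ r R̃ D_T̃` on `Γ ⊗ 𝒟_T`
(for a row contraction and `0 ≤ r < 1` the inverse exists because `‖r R̃ T̃*‖ < 1`). -/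
def charFunAt (T : Fin n → H →L[ℂ] H) (r : ℝ) :
    FockTensor n (DSpace T) →L[ℂ] FockTensor n (DStarSpace T) :=
  -idTensor (rowOpDefect T) +
    idTensor (defectOpOnto (ContinuousLinearMap.adjoint (rowOp T))) ∘L
      Ring.inverse (1 - (r : ℂ) • creationAdj T) ∘L ((r : ℂ) • creationDefect T)

/-- `Θ` is the limit of `Θ_T(r R̃)` in the strong operator topology as `r → 1⁻`. -/
def IsCharFun (T : Fin n → H →L[ℂ] H)
    (Θ : FockTensor n (DSpace T) →L[ℂ] FockTensor n (DStarSpace T)) : Prop :=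
  ∀ f, Tendsto (fun r : ℝ => charFunAt T r f) (𝓝[<] 1) (𝓝 (Θ f))

open Classical in
/-- The characteristic function `Θ_T = SOT-lim_{r → 1⁻} Θ_T(r R̃)` of a row contraction `T`. -/
def charFun (T : Fin n → H →L[ℂ] H) :
    FockTensor n (DSpace T) →L[ℂ] FockTensor n (DStarSpace T) :=
  if h : ∃ Θ, IsCharFun T Θ then h.choose else 0

end CharFun

section CharFunFacts

variable {n : ℕ} {H : Type*} [NormedAddCommGroup H] [InnerProductSpace ℂ H]

/-- Every word is either empty or ends in exactly one letter. -/
def wordEquiv (n : ℕ) : Option (FreeMonoid (Fin n) × Fin n) ≃ FreeMonoid (Fin n) :=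
  Equiv.ofBijective (fun o => o.elim 1 (fun p => p.1 * FreeMonoid.of p.2)) (by
    constructor
    · rintro (_ | ⟨v, i⟩) (_ | ⟨w, j⟩) h
      · rfl
      · have := congrArg FreeMonoid.length h
        simp at this
      · have := congrArg FreeMonoid.length h
        simp at this
      · have h' : (FreeMonoid.toList v) ++ [i] = (FreeMonoid.toList w) ++ [j] := h
        have h1 := List.append_inj' h' rfl
        obtain ⟨h2, h3⟩ := h1
        have h4 : v = w := h2
        simp only [List.cons.injEq, and_true] at h3
        rw [h4, h3]
    · intro w
      rcases List.eq_nil_or_concat (FreeMonoid.toList w) with h | ⟨v, i, h⟩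
      · exact ⟨none, h.symm⟩
      · refine ⟨some (FreeMonoid.ofList v, i), ?_⟩
        rw [List.concat_eq_append] at h
        exact h.symm)

theorem tsum_words (φ : FreeMonoid (Fin n) → ℝ) (hφ : Summable φ) :
    ∑' w, φ w = φ 1 + ∑' w, ∑ j, φ (w * FreeMonoid.of j) := by
  have h1 : Summable (φ ∘ wordEquiv n) := (wordEquiv n).summable_iff.2 hφ
  have h2 : Summable fun p : FreeMonoid (Fin n) × Fin n => φ (p.1 * FreeMonoid.of p.2) :=
    h1.comp_injective (i := some) (Option.some_injective _)
  classical
  rw [← (wordEquiv n).tsum_eq, Summable.tsum_eq_add_tsum_ite (f := fun o => φ (wordEquiv n o)) h1 none]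
  congr 1
  rw [← (Option.some_injective _).tsum_eq]
  swap
  · rintro (_ | p) hp
    · simp at hp
    · exact ⟨p, rfl⟩
  refine Eq.trans (tsum_congr fun p => if_neg (Option.some_ne_none p)) ?_
  refine (Summable.tsum_prod h2).trans (tsum_congr fun w => ?_)
  rw [tsum_fintype]

/-- The row of right creation operators `(g_1, …, g_n) ↦ ∑ R_j g_j`. -/
def rowCreation : FockTensor n (PiLp 2 (fun _ : Fin n => H)) →L[ℂ] FockTensor n H :=
  ∑ j, rightCreation j ∘L idTensor (PiLp.proj 2 (fun _ : Fin n => H) j)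

theorem rightCreation_apply_one (j : Fin n) (f : FockTensor n H) : rightCreation j f 1 = 0 := by
  refine Function.extend_apply' _ _ _ ?_
  rintro ⟨v, hv⟩
  have := congrArg FreeMonoid.length hv
  simp at this

theorem rightCreation_apply_mul_ne {i j : Fin n} (hij : i ≠ j) (f : FockTensor n H)
    (w : FreeMonoid (Fin n)) : rightCreation j f (w * FreeMonoid.of i) = 0 := by
  refine Function.extend_apply' _ _ _ ?_
  rintro ⟨v, hv⟩
  have := (wordEquiv n).injective (a₁ := some (v, j)) (a₂ := some (w, i)) hv
  simp only [Option.some.injEq, Prod.mk.injEq] at this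
  exact hij this.2.symm

theorem rowCreation_apply (g : FockTensor n (PiLp 2 (fun _ : Fin n => H)))
    (w : FreeMonoid (Fin n)) : rowCreation g w =
      ∑ j, rightCreation j (idTensor (PiLp.proj 2 (fun _ : Fin n => H) j) g) w := by
  have : rowCreation g = ∑ j, rightCreation j (idTensor (PiLp.proj 2 (fun _ : Fin n => H) j) g) := by
    simp [rowCreation]
  rw [this, lp.coeFn_sum, Finset.sum_apply]

theorem rowCreation_apply_one (g : FockTensor n (PiLp 2 (fun _ : Fin n => H))) :
    rowCreation g 1 = 0 := by
  rw [rowCreation_apply]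
  exact Finset.sum_eq_zero fun j _ => rightCreation_apply_one j _

theorem rowCreation_apply_mul (g : FockTensor n (PiLp 2 (fun _ : Fin n => H)))
    (w : FreeMonoid (Fin n)) (i : Fin n) : rowCreation g (w * FreeMonoid.of i) = g w i := by
  rw [rowCreation_apply, Finset.sum_eq_single i]
  · rw [rightCreation_apply_mul]
    rfl
  · intro j _ hj
    exact rightCreation_apply_mul_ne hj.symm _ _
  · simp

theorem norm_rowCreation (g : FockTensor n (PiLp 2 (fun _ : Fin n => H))) :
    ‖rowCreation g‖ ^ 2 = ‖g‖ ^ 2 := by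
  rw [fock_norm_sq, fock_norm_sq, tsum_words _ (fock_summable _), rowCreation_apply_one]
  simp [rowCreation_apply_mul, PiLp.norm_sq_eq_of_L2]

variable [CompleteSpace H]

theorem rowOp_adjoint_apply (T : Fin n → H →L[ℂ] H) (h : H) (j : Fin n) :
    ContinuousLinearMap.adjoint (rowOp T) h j = ContinuousLinearMap.adjoint (T j) h := by
  refine ext_inner_right ℂ fun k => ?_
  have h1 : ⟪ContinuousLinearMap.adjoint (rowOp T) h, PiLp.single 2 j k⟫_ℂ = ⟪h, T j k⟫_ℂ := by
    rw [ContinuousLinearMap.adjoint_inner_left]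
    congr 1
    simp only [rowOp, sum_apply, ContinuousLinearMap.comp_apply,
      PiLp.proj_apply]
    rw [Finset.sum_eq_single j]
    · simp
    · intro i _ hi
      simp [hi]
    · simp
  rw [ContinuousLinearMap.adjoint_inner_left, ← h1]
  rw [PiLp.inner_apply, Finset.sum_eq_single j]
  · simp
  · intro i _ hi
    simp [hi]
  · simp

theorem creationAdj_eq (T : Fin n → H →L[ℂ] H) (h : FockTensor n H) :
    creationAdj T h = rowCreation (idTensor (ContinuousLinearMap.adjoint (rowOp T)) h) := by
  simp only [creationAdj, rowCreation, sum_apply,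
    ContinuousLinearMap.comp_apply]
  refine Finset.sum_congr rfl fun j _ => ?_
  congr 1
  ext w
  simp [rowOp_adjoint_apply]

theorem creationDefect_eq (T : Fin n → H →L[ℂ] H) (f : FockTensor n (DSpace T)) :
    creationDefect T f =
      rowCreation (idTensor (defectOp (rowOp T) ∘L (DSpace T).subtypeL) f) := by
  simp only [creationDefect, rowCreation, sum_apply,
    ContinuousLinearMap.comp_apply]
  refine Finset.sum_congr rfl fun j _ => ?_
  congr 1

theorem norm_idTensor_le {E F : Type*} [NormedAddCommGroup E] [InnerProductSpace ℂ E]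
    [NormedAddCommGroup F] [InnerProductSpace ℂ F] (A : E →L[ℂ] F) :
    ‖(idTensor A : FockTensor n E →L[ℂ] FockTensor n F)‖ ≤ ‖A‖ :=
  LinearMap.mkContinuous_norm_le _ (norm_nonneg _) _

theorem norm_creationAdj_le (T : Fin n → H →L[ℂ] H) (hT : IsRowContraction T) :
    ‖creationAdj T‖ ≤ 1 := by
  refine ContinuousLinearMap.opNorm_le_bound _ zero_le_one fun h => ?_
  rw [one_mul, creationAdj_eq]
  refine le_of_sq_le_sq ?_ (norm_nonneg _)
  rw [norm_rowCreation]
  refine pow_le_pow_left₀ (norm_nonneg _) ?_ 2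
  refine (ContinuousLinearMap.le_opNorm _ _).trans ?_
  have h1 : ‖(idTensor (ContinuousLinearMap.adjoint (rowOp T)) : FockTensor n H →L[ℂ] _)‖ ≤ 1 :=
    (norm_idTensor_le _).trans ((ContinuousLinearMap.adjoint.norm_map (rowOp T)).trans_le hT)
  nlinarith [norm_nonneg h]

/-- The vector `(I - r R̃ T̃*)⁻¹ r R̃ D_T̃ f`. -/
def charState (T : Fin n → H →L[ℂ] H) (r : ℝ) (f : FockTensor n (DSpace T)) : FockTensor n H :=
  Ring.inverse (1 - (r : ℂ) • creationAdj T) (((r : ℂ) • creationDefect T) f)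

theorem charState_eq (T : Fin n → H →L[ℂ] H) (hT : IsRowContraction T) {r : ℝ}
    (hr0 : 0 ≤ r) (hr : r < 1) (f : FockTensor n (DSpace T)) :
    charState T r f = (r : ℂ) • rowCreation
      (idTensor (ContinuousLinearMap.adjoint (rowOp T)) (charState T r f) +
        idTensor (defectOp (rowOp T) ∘L (DSpace T).subtypeL) f) := by
  have h1 : ‖(r : ℂ) • creationAdj T‖ < 1 := by
    rw [norm_smul]
    have := norm_creationAdj_le T hT
    have h2 : ‖(r : ℂ)‖ = r := by simp [abs_of_nonneg hr0]
    rw [h2]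
    nlinarith [norm_nonneg (creationAdj T)]
  have hu : IsUnit (1 - (r : ℂ) • creationAdj T) := (Units.oneSub _ h1).isUnit
  have h3 := congrArg (fun M : FockTensor n H →L[ℂ] FockTensor n H =>
    M (((r : ℂ) • creationDefect T) f)) (Ring.mul_inverse_cancel _ hu)
  change (1 - (r : ℂ) • creationAdj T) (charState T r f) = (r : ℂ) • creationDefect T f at h3
  rw [sub_apply, sub_eq_iff_eq_add] at h3
  change charState T r f = _ + (r : ℂ) • creationAdj T (charState T r f) at h3
  rw [map_add, smul_add, ← creationAdj_eq, ← creationDefect_eq, add_comm]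
  exact h3

theorem charState_one (T : Fin n → H →L[ℂ] H) (hT : IsRowContraction T) {r : ℝ}
    (hr0 : 0 ≤ r) (hr : r < 1) (f : FockTensor n (DSpace T)) : charState T r f 1 = 0 := by
  rw [charState_eq T hT hr0 hr f, lp.coeFn_smul, Pi.smul_apply, rowCreation_apply_one, smul_zero]

theorem charState_mul (T : Fin n → H →L[ℂ] H) (hT : IsRowContraction T) {r : ℝ}
    (hr0 : 0 ≤ r) (hr : r < 1) (f : FockTensor n (DSpace T)) (w : FreeMonoid (Fin n))
    (j : Fin n) : charState T r f (w * FreeMonoid.of j) = (r : ℂ) •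
      ((ContinuousLinearMap.adjoint (rowOp T) (charState T r f w) +
        defectOp (rowOp T) (f w : PiLp 2 (fun _ : Fin n => H))) j) := by
  conv_lhs => rw [charState_eq T hT hr0 hr f]
  rw [lp.coeFn_smul, Pi.smul_apply, rowCreation_apply_mul]
  rfl

theorem rowOp_mem (T : Fin n → H →L[ℂ] H) (hT : IsRowContraction T)
    (x : PiLp 2 (fun _ : Fin n => H)) (hx : x ∈ DSpace T) : rowOp T x ∈ DStarSpace T := by
  have h : DSpace T ≤ (DStarSpace T).comap (rowOp T).toLinearMap := by
    refine Submodule.topologicalClosure_minimal _ ?_ ?_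
    · rintro _ ⟨y, rfl⟩
      refine Submodule.le_topologicalClosure _ ⟨rowOp T y, ?_⟩
      exact (defect_intertwine (rowOp T) hT y).symm
    · exact (Submodule.isClosed_topologicalClosure _).preimage (rowOp T).continuous
  exact h hx

theorem rowOpDefect_coe (T : Fin n → H →L[ℂ] H) (hT : IsRowContraction T) (x : DSpace T) :
    (rowOpDefect T x : H) = rowOp T x :=
  Submodule.starProjection_eq_self_iff.2 (rowOp_mem T hT x x.2)

theorem charFunAt_apply (T : Fin n → H →L[ℂ] H) (hT : IsRowContraction T) (r : ℝ)
    (f : FockTensor n (DSpace T)) (w : FreeMonoid (Fin n)) :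
    (charFunAt T r f w : H) =
      defectOp (ContinuousLinearMap.adjoint (rowOp T)) (charState T r f w) -
        rowOp T (f w : PiLp 2 (fun _ : Fin n => H)) := by
  have h : charFunAt T r f w = -rowOpDefect T (f w) +
    defectOpOnto (ContinuousLinearMap.adjoint (rowOp T)) (charState T r f w) := rfl
  rw [h, Submodule.coe_add, Submodule.coe_neg, rowOpDefect_coe T hT, neg_add_eq_sub]
  rfl

theorem norm_charFunAt_le (T : Fin n → H →L[ℂ] H) (hT : IsRowContraction T) {r : ℝ}
    (hr0 : 0 ≤ r) (hr : r < 1) (f : FockTensor n (DSpace T)) : ‖charFunAt T r f‖ ≤ ‖f‖ := by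
  refine le_of_sq_le_sq ?_ (norm_nonneg _)
  set h := charState T r f with hh
  set g : FockTensor n (PiLp 2 (fun _ : Fin n => H)) :=
    idTensor (ContinuousLinearMap.adjoint (rowOp T)) h +
        idTensor (defectOp (rowOp T) ∘L (DSpace T).subtypeL) f with hg
  have h1 : ‖h‖ ^ 2 = r ^ 2 * ‖g‖ ^ 2 := by
    have := charState_eq T hT hr0 hr f
    rw [hh, this, norm_smul, mul_pow, norm_rowCreation]
    simp [hg, hh]
  have h2 : ∀ w, ‖g w‖ ^ 2 + ‖charFunAt T r f w‖ ^ 2 = ‖h w‖ ^ 2 + ‖f w‖ ^ 2 := by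
    intro w
    have := julia_norm (rowOp T) hT (h w) (f w : PiLp 2 (fun _ : Fin n => H))
    rw [← charFunAt_apply T hT] at this
    exact this
  have h3 : ‖g‖ ^ 2 + ‖charFunAt T r f‖ ^ 2 = ‖h‖ ^ 2 + ‖f‖ ^ 2 := by
    simp only [fock_norm_sq]
    rw [← Summable.tsum_add (fock_summable _) (fock_summable _),
      ← Summable.tsum_add (fock_summable _) (fock_summable _)]
    exact tsum_congr h2
  have h4 : r ^ 2 ≤ 1 := pow_le_one₀ hr0 hr.le
  nlinarith [mul_nonneg (sub_nonneg.2 h4) (sq_nonneg ‖g‖)]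

theorem charState_scale (T : Fin n → H →L[ℂ] H) (hT : IsRowContraction T) {r s : ℝ}
    (hr0 : 0 ≤ r) (hr : r < 1) (hs0 : 0 ≤ s) (hs : s < 1) (u : FreeMonoid (Fin n))
    (f : FockTensor n (DSpace T)) (hf : ∀ v, v ≠ u → f v = 0) (w : FreeMonoid (Fin n)) :
    ((s : ℂ) ^ w.length * (r : ℂ) ^ u.length) • charState T r f w =
      ((r : ℂ) ^ w.length * (s : ℂ) ^ u.length) • charState T s f w := by
  have key : ∀ l : List (Fin n),
      ((s : ℂ) ^ l.length * (r : ℂ) ^ u.length) • charState T r f (FreeMonoid.ofList l) =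
      ((r : ℂ) ^ l.length * (s : ℂ) ^ u.length) • charState T s f (FreeMonoid.ofList l) := by
    intro l
    induction l using List.reverseRecOn with
    | nil =>
      have h1 := charState_one T hT hr0 hr f
      have h2 := charState_one T hT hs0 hs f
      change _ • charState T r f 1 = _ • charState T s f 1
      rw [h1, h2, smul_zero, smul_zero]
    | append_singleton l j ih =>
      have h1 := charState_mul T hT hr0 hr f (FreeMonoid.ofList l) j
      have h2 := charState_mul T hT hs0 hs f (FreeMonoid.ofList l) j
      change _ • charState T r f (FreeMonoid.ofList l * FreeMonoid.of j) =
        _ • charState T s f (FreeMonoid.ofList l * FreeMonoid.of j)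
      have h3 : ((s : ℂ) ^ l.length * (r : ℂ) ^ u.length) •
          (f (FreeMonoid.ofList l) : PiLp 2 (fun _ : Fin n => H)) =
          ((r : ℂ) ^ l.length * (s : ℂ) ^ u.length) •
          (f (FreeMonoid.ofList l) : PiLp 2 (fun _ : Fin n => H)) := by
        by_cases hl : FreeMonoid.ofList l = u
        · have : l.length = u.length := by rw [← hl]; rfl
          rw [this, mul_comm]
        · simp [hf _ hl]
      have h4 : ((s : ℂ) ^ l.length * (r : ℂ) ^ u.length) •
          (ContinuousLinearMap.adjoint (rowOp T) (charState T r f (FreeMonoid.ofList l)) +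
            defectOp (rowOp T) (f (FreeMonoid.ofList l) : PiLp 2 (fun _ : Fin n => H))) =
          ((r : ℂ) ^ l.length * (s : ℂ) ^ u.length) •
          (ContinuousLinearMap.adjoint (rowOp T) (charState T s f (FreeMonoid.ofList l)) +
            defectOp (rowOp T) (f (FreeMonoid.ofList l) : PiLp 2 (fun _ : Fin n => H))) := by
        rw [smul_add, smul_add, ← map_smul, ← map_smul, ← map_smul, ← map_smul, ih, h3]
      have h5 := congrArg (fun z : PiLp 2 (fun _ : Fin n => H) => ((r : ℂ) * s) • z j) h4
      simp only [PiLp.smul_apply, smul_smul] at h5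
      rw [h1, h2, smul_smul, smul_smul, List.length_append, List.length_singleton, pow_succ,
        pow_succ]
      convert h5 using 2 <;> ring
  exact key (FreeMonoid.toList w)

theorem charFunAt_scale (T : Fin n → H →L[ℂ] H) (hT : IsRowContraction T) {r s : ℝ}
    (hr0 : 0 ≤ r) (hr : r < 1) (hs0 : 0 ≤ s) (hs : s < 1) (u : FreeMonoid (Fin n))
    (f : FockTensor n (DSpace T)) (hf : ∀ v, v ≠ u → f v = 0) (w : FreeMonoid (Fin n)) :
    ((s : ℂ) ^ w.length * (r : ℂ) ^ u.length) • charFunAt T r f w =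
      ((r : ℂ) ^ w.length * (s : ℂ) ^ u.length) • charFunAt T s f w := by
  have h3 : ((s : ℂ) ^ w.length * (r : ℂ) ^ u.length) •
      (f w : PiLp 2 (fun _ : Fin n => H)) =
      ((r : ℂ) ^ w.length * (s : ℂ) ^ u.length) • (f w : PiLp 2 (fun _ : Fin n => H)) := by
    by_cases hl : w = u
    · rw [hl, mul_comm]
    · simp [hf _ hl]
  apply Subtype.ext
  rw [Submodule.coe_smul, Submodule.coe_smul, charFunAt_apply T hT, charFunAt_apply T hT,
    smul_sub, smul_sub, ← map_smul, ← map_smul, ← map_smul, ← map_smul, h3,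
    charState_scale T hT hr0 hr hs0 hs u f hf]

theorem tendsto_charFunAt_of_support (T : Fin n → H →L[ℂ] H) (hT : IsRowContraction T)
    (u : FreeMonoid (Fin n)) (f : FockTensor n (DSpace T)) (hf : ∀ v, v ≠ u → f v = 0) :
    ∃ y, Tendsto (fun r : ℝ => charFunAt T r f) (𝓝[<] 1) (𝓝 y) := by
  let b : FreeMonoid (Fin n) → DStarSpace T := fun w =>
    ((2 : ℂ) ^ w.length * (2⁻¹ : ℂ) ^ u.length) • charFunAt T 2⁻¹ f w
  have hb : ∀ r : ℝ, 0 < r → r < 1 → ∀ w, charFunAt T r f w =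
      ((r ^ w.length * r⁻¹ ^ u.length : ℝ) : ℂ) • b w := by
    intro r hr0 hr w
    have h := charFunAt_scale T hT hr0.le hr (s := 2⁻¹) (by norm_num) (by norm_num) u f hf w
    have hr' : (r : ℂ) ≠ 0 := by exact_mod_cast hr0.ne'
    have h' := congrArg (fun z => ((2 : ℂ) ^ w.length * (r : ℂ)⁻¹ ^ u.length) • z) h
    simp only [smul_smul, b] at h' ⊢
    have e1 : (2 : ℂ) ^ w.length * (r : ℂ)⁻¹ ^ u.length *
        (((2⁻¹ : ℝ) : ℂ) ^ w.length * (r : ℂ) ^ u.length) = 1 := by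
      have a1 : (2 : ℂ) ^ w.length * ((2⁻¹ : ℝ) : ℂ) ^ w.length = 1 := by
        rw [← mul_pow]
        norm_num
      have a2 : (r : ℂ)⁻¹ ^ u.length * (r : ℂ) ^ u.length = 1 := by
        rw [← mul_pow, inv_mul_cancel₀ hr', one_pow]
      calc _ = ((2 : ℂ) ^ w.length * ((2⁻¹ : ℝ) : ℂ) ^ w.length) *
            ((r : ℂ)⁻¹ ^ u.length * (r : ℂ) ^ u.length) := by ring
        _ = 1 := by rw [a1, a2, one_mul]
    rw [e1, one_smul] at h'
    rw [h']
    congr 1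
    push_cast
    ring
  clear_value b
  have hev : ∀ᶠ r : ℝ in 𝓝[<] 1, 2⁻¹ < r ∧ r < 1 := by
    have : Set.Ioo (2⁻¹ : ℝ) 1 ∈ 𝓝[<] (1 : ℝ) := Ioo_mem_nhdsLT (by norm_num)
    exact this
  have hlim : ∀ w : FreeMonoid (Fin n),
      Tendsto (fun r : ℝ => r ^ w.length * r⁻¹ ^ u.length) (𝓝[<] 1) (𝓝 1) := by
    intro w
    have hc : ContinuousAt (fun r : ℝ => r ^ w.length * r⁻¹ ^ u.length) 1 :=
      (continuousAt_id.pow _).mul ((continuousAt_inv₀ one_ne_zero).pow _)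
    have := hc.tendsto
    simp only [one_pow, inv_one, mul_one] at this
    exact this.mono_left nhdsWithin_le_nhds
  have hsum : Summable fun w => ‖b w‖ ^ 2 := by
    refine summable_of_sum_le (c := ‖f‖ ^ 2) (fun w => by positivity) fun s => ?_
    have h1 : Tendsto (fun r : ℝ => ∑ w ∈ s, (r ^ w.length * r⁻¹ ^ u.length) ^ 2 * ‖b w‖ ^ 2)
        (𝓝[<] 1) (𝓝 (∑ w ∈ s, (1 : ℝ) ^ 2 * ‖b w‖ ^ 2)) :=
      tendsto_finsetSum _ fun w _ => ((hlim w).pow 2).mul_const _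
    simp only [one_pow, one_mul] at h1
    refine le_of_tendsto h1 ?_
    filter_upwards [hev] with r hr
    have hr0 : 0 < r := by linarith [hr.1]
    have h2 : ∀ w, (r ^ w.length * r⁻¹ ^ u.length) ^ 2 * ‖b w‖ ^ 2 = ‖charFunAt T r f w‖ ^ 2 := by
      intro w
      rw [hb r hr0 hr.2 w, norm_smul, Complex.norm_real, Real.norm_eq_abs, mul_pow |_|, sq_abs]
    simp only [h2]
    refine (Summable.sum_le_tsum s (fun _ _ => by positivity) (fock_summable _)).trans ?_
    rw [← fock_norm_sq]
    exact pow_le_pow_left₀ (norm_nonneg _) (norm_charFunAt_le T hT hr0.le hr.2 f) 2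
  let y : FockTensor n (DStarSpace T) := ⟨b, (memlp_two_iff b).2 hsum⟩
  refine ⟨y, ?_⟩
  rw [tendsto_iff_norm_sub_tendsto_zero]
  have h1 : Tendsto (fun r : ℝ => ∑' w, ((r ^ w.length * r⁻¹ ^ u.length - 1) * ‖b w‖) ^ 2)
      (𝓝[<] 1) (𝓝 (∑' w : FreeMonoid (Fin n), ((1 - 1 : ℝ) * ‖b w‖) ^ 2)) := by
    refine tendsto_tsum_of_dominated_convergence
      (bound := fun w => (2 ^ u.length + 1) ^ 2 * ‖b w‖ ^ 2) (hsum.mul_left _) ?_ ?_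
    · intro w
      exact (((hlim w).sub_const 1).mul_const _).pow 2
    · filter_upwards [hev] with r hr w
      have hr0 : 0 < r := by linarith [hr.1]
      rw [Real.norm_of_nonneg (by positivity), mul_pow]
      refine mul_le_mul_of_nonneg_right ?_ (by positivity)
      have a1 : r ^ w.length ≤ 1 := pow_le_one₀ hr0.le hr.2.le
      have a2 : r⁻¹ ^ u.length ≤ 2 ^ u.length := by
        refine pow_le_pow_left₀ (by positivity) ?_ _
        rw [inv_le_comm₀ hr0 (by norm_num)]
        exact hr.1.le
      have a3 : 0 ≤ r ^ w.length := by positivity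
      have a4 : 0 ≤ r⁻¹ ^ u.length := by positivity
      have a5 : r ^ w.length * r⁻¹ ^ u.length ≤ 2 ^ u.length := by nlinarith
      have a6 : 0 ≤ r ^ w.length * r⁻¹ ^ u.length := mul_nonneg a3 a4
      nlinarith
  simp only [sub_self, zero_mul, ne_eq, OfNat.ofNat_ne_zero, not_false_eq_true, zero_pow,
    tsum_zero] at h1
  have h2 : Tendsto (fun r : ℝ => ‖charFunAt T r f - y‖ ^ 2) (𝓝[<] 1) (𝓝 0) := by
    refine h1.congr' ?_
    filter_upwards [hev] with r hr
    have hr0 : 0 < r := by linarith [hr.1]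
    rw [fock_norm_sq]
    refine tsum_congr fun w => ?_
    have : (charFunAt T r f - y) w =
        ((r ^ w.length * r⁻¹ ^ u.length - 1 : ℝ) : ℂ) • b w := by
      rw [lp.coeFn_sub]
      change charFunAt T r f w - b w = _
      rw [hb r hr0 hr.2 w]
      push_cast
      rw [sub_smul, one_smul]
    rw [this, norm_smul, Complex.norm_real, mul_pow, mul_pow, Real.norm_eq_abs, sq_abs]
  have h3 := h2.sqrt
  simpa [Real.sqrt_sq (norm_nonneg _)] using h3

theorem tendsto_charFunAt (T : Fin n → H →L[ℂ] H) (hT : IsRowContraction T)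
    (f : FockTensor n (DSpace T)) :
    ∃ y, Tendsto (fun r : ℝ => charFunAt T r f) (𝓝[<] 1) (𝓝 y) := by
  classical
  have hev : ∀ᶠ r : ℝ in 𝓝[<] 1, 0 ≤ r ∧ r < 1 := by
    have : Set.Ioo (0 : ℝ) 1 ∈ 𝓝[<] (1 : ℝ) := Ioo_mem_nhdsLT (by norm_num)
    filter_upwards [this] with r hr using ⟨hr.1.le, hr.2⟩
  have hfin : ∀ s : Finset (FreeMonoid (Fin n)), ∃ y,
      Tendsto (fun r : ℝ => charFunAt T r (∑ u ∈ s, lp.single (E := fun _ => DSpace T) 2 u (f u))) (𝓝[<] 1) (𝓝 y) := by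
    intro s
    have h : ∀ u : FreeMonoid (Fin n), ∃ y,
        Tendsto (fun r : ℝ => charFunAt T r (lp.single (E := fun _ => DSpace T) 2 u (f u))) (𝓝[<] 1) (𝓝 y) :=
      fun u => tendsto_charFunAt_of_support T hT u _ fun v hv => lp.single_apply_ne (E := fun _ => DSpace T) 2 u (f u) hv
    choose y hy using h
    refine ⟨∑ u ∈ s, y u, ?_⟩
    simp only [map_sum]
    exact tendsto_finsetSum _ fun u _ => hy u
  have hdense := lp.hasSum_single (p := 2) (by norm_num) f
  refine cauchy_map_iff_exists_tendsto.1 (Metric.cauchy_iff.2 ⟨inferInstance, fun ε hε => ?_⟩)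
  have h1 : ∀ᶠ s in atTop, dist (∑ u ∈ s, lp.single (E := fun _ => DSpace T) 2 u (f u)) f < ε / 3 :=
    (Metric.tendsto_nhds.1 hdense) (ε / 3) (by positivity)
  obtain ⟨s, hs⟩ := h1.exists
  obtain ⟨y, hy⟩ := hfin s
  have h2 := (Metric.cauchy_iff.1 hy.cauchy_map).2 (ε / 3) (by positivity)
  obtain ⟨t, ht, ht2⟩ := h2
  refine ⟨(fun r : ℝ => charFunAt T r f) ''
    ((fun r : ℝ => charFunAt T r (∑ u ∈ s, lp.single (E := fun _ => DSpace T) 2 u (f u))) ⁻¹' t ∩ {r | 0 ≤ r ∧ r < 1}),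
    image_mem_map (inter_mem ht hev), ?_⟩
  rintro _ ⟨r, ⟨hr1, hr0, hr⟩, rfl⟩ _ ⟨q, ⟨hq1, hq0, hq⟩, rfl⟩
  have c : ∀ r : ℝ, 0 ≤ r → r < 1 →
      dist (charFunAt T r f) (charFunAt T r (∑ u ∈ s, lp.single (E := fun _ => DSpace T) 2 u (f u))) < ε / 3 := by
    intro r hr0 hr
    rw [dist_eq_norm, ← map_sub]
    refine (norm_charFunAt_le T hT hr0 hr _).trans_lt ?_
    rw [← dist_eq_norm, dist_comm]
    exact hs
  have c1 := c r hr0 hr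
  have c2 := c q hq0 hq
  rw [dist_comm] at c2
  have c3 := ht2 _ hr1 _ hq1
  have c4 := dist_triangle4 (charFunAt T r f) (charFunAt T r (∑ u ∈ s, lp.single (E := fun _ => DSpace T) 2 u (f u)))
    (charFunAt T q (∑ u ∈ s, lp.single (E := fun _ => DSpace T) 2 u (f u))) (charFunAt T q f)
  linarith

/-- For a row contraction the strong limit that defines `Θ_T` exists. -/
theorem exists_isCharFun (T : Fin n → H →L[ℂ] H) (hT : IsRowContraction T) :
    ∃ Θ, IsCharFun T Θ := by
  choose y hy using tendsto_charFunAt T hT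
  have hev : ∀ᶠ r : ℝ in 𝓝[<] 1, 0 ≤ r ∧ r < 1 := by
    have : Set.Ioo (0 : ℝ) 1 ∈ 𝓝[<] (1 : ℝ) := Ioo_mem_nhdsLT (by norm_num)
    filter_upwards [this] with r hr using ⟨hr.1.le, hr.2⟩
  refine ⟨LinearMap.mkContinuous
    { toFun := y
      map_add' := fun f g => tendsto_nhds_unique (hy (f + g))
        (((hy f).add (hy g)).congr fun r => (map_add _ _ _).symm)
      map_smul' := fun c f => tendsto_nhds_unique (hy (c • f))
        (((hy f).const_smul c).congr fun r => (map_smul _ _ _).symm) } 1 (fun f => ?_), hy⟩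
  rw [one_mul]
  refine le_of_tendsto (hy f).norm ?_
  filter_upwards [hev] with r hr using norm_charFunAt_le T hT hr.1 hr.2 f

/-- For a row contraction `Θ_T` is the strong limit of `Θ_T(r R̃)`. -/
theorem charFun_spec (T : Fin n → H →L[ℂ] H) (hT : IsRowContraction T) :
    IsCharFun T (charFun T) := by
  have h := exists_isCharFun T hT
  rw [charFun, dif_pos h]
  exact h.choose_spec

end CharFunFacts

section Variety

variable {n : ℕ}

/-- The value `p(T_1, …, T_n)` of a noncommutative polynomial. -/
def evalPoly {H : Type*} [NormedAddCommGroup H] [InnerProductSpace ℂ H]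
    (T : Fin n → H →L[ℂ] H) (p : FreeAlgebra ℂ (Fin n)) : H →L[ℂ] H :=
  FreeAlgebra.lift ℂ T p

/-- A set of operators is closed in the weak operator topology. -/
def IsWOTClosed {H : Type*} [NormedAddCommGroup H] [InnerProductSpace ℂ H]
    (s : Set (H →L[ℂ] H)) : Prop :=
  IsClosed {A : H →WOT[ℂ] H | A.toCLM ∈ s}

variable (n) in
/-- The noncommutative analytic Toeplitz algebra `F_n^∞`: the closure in the weak operator topology
of the algebra of polynomials in `L_1, …, L_n`. -/
def toeplitzAlg : Set (Fock n →L[ℂ] Fock n) :=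
  {A | ContinuousLinearMapWOT.ofCLM A ∈ closure
    {B : Fock n →WOT[ℂ] Fock n | ∃ p, B.toCLM = evalPoly leftCreation p}}

/-- `K` is a two-sided ideal of `F_n^∞`, closed in the weak operator topology. -/
structure IsWOTIdeal (K : Submodule ℂ (Fock n →L[ℂ] Fock n)) : Prop where
  subset : ∀ A ∈ K, A ∈ toeplitzAlg n
  mul_left : ∀ B ∈ toeplitzAlg n, ∀ A ∈ K, B ∘L A ∈ K
  mul_right : ∀ B ∈ toeplitzAlg n, ∀ A ∈ K, A ∘L B ∈ K
  closed : IsWOTClosed (K : Set (Fock n →L[ℂ] Fock n))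

/-- The WOT-closed two-sided ideal `J` of `F_n^∞` generated by the polynomials in `P`. -/
def wotIdeal (P : Set (FreeAlgebra ℂ (Fin n))) : Submodule ℂ (Fock n →L[ℂ] Fock n) :=
  sInf {K | IsWOTIdeal K ∧ ∀ p ∈ P, evalPoly leftCreation p ∈ K}

/-- `ℳ_J`, the closed span of `φ ⊗ ψ = φ ψ` for `φ ∈ J` and `ψ ∈ Γ`. -/
def subspaceM (P : Set (FreeAlgebra ℂ (Fin n))) : Submodule ℂ (Fock n) :=
  (Submodule.span ℂ {x | ∃ φ ∈ wotIdeal P, ∃ ψ : Fock n, x = φ ψ}).topologicalClosure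

/-- `𝒩_J = Γ ⊖ ℳ_J`. -/
def subspaceN (P : Set (FreeAlgebra ℂ (Fin n))) : Submodule ℂ (Fock n) := (subspaceM P)ᗮ

/-- `T` is a `J`-constrained row contraction, where `J` is generated by `P`. -/
def IsConstrained {H : Type*} [NormedAddCommGroup H] [InnerProductSpace ℂ H] [CompleteSpace H]
    (P : Set (FreeAlgebra ℂ (Fin n))) (T : Fin n → H →L[ℂ] H) : Prop :=
  IsRowContraction T ∧ ∀ p ∈ P, evalPoly T p = 0

variable {E : Type*} [NormedAddCommGroup E] [InnerProductSpace ℂ E]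
variable {F : Type*} [NormedAddCommGroup F] [InnerProductSpace ℂ F]

variable (E) in
/-- The closed subspace `N ⊗ E` of `Γ ⊗ E`, for a subspace `N` of `Γ`. -/
def subTensor (N : Submodule ℂ (Fock n)) : Submodule ℂ (FockTensor n E) :=
  (Submodule.span ℂ {f | ∃ x ∈ N, ∃ η : E, f = elem x η}).topologicalClosure

instance (N : Submodule ℂ (Fock n)) [CompleteSpace E] : CompleteSpace (subTensor E N) :=
  inferInstanceAs (CompleteSpace (Submodule.topologicalClosure _))

theorem idTensor_mem (N : Submodule ℂ (Fock n)) (A : E →L[ℂ] F) (f : FockTensor n E)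
    (hf : f ∈ subTensor E N) : idTensor A f ∈ subTensor F N := by
  have h : subTensor E N ≤ (subTensor F N).comap (idTensor (n := n) A).toLinearMap := by
    refine Submodule.topologicalClosure_minimal _ (Submodule.span_le.2 ?_) ?_
    · rintro _ ⟨x, hx, η, rfl⟩
      refine Submodule.le_topologicalClosure _ (Submodule.subset_span ⟨x, hx, A η, ?_⟩)
      exact idTensor_elem A x η
    · exact (Submodule.isClosed_topologicalClosure _).preimage (idTensor A).continuous
  exact h hf

/-- The operator `I_N ⊗ A` from `N ⊗ E` to `N ⊗ F`. -/
def idTensorOn (N : Submodule ℂ (Fock n)) (A : E →L[ℂ] F) : subTensor E N →L[ℂ] subTensor F N :=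
  (idTensor A ∘L (subTensor E N).subtypeL).codRestrict (subTensor F N)
    (fun f => idTensor_mem N A f f.2)

/-- The constrained characteristic function
`Θ_{J,T} = P_{𝒩_J ⊗ 𝒟_{T*}} Θ_T |_{𝒩_J ⊗ 𝒟_T}`. -/
def constrCharFun {H : Type*} [NormedAddCommGroup H] [InnerProductSpace ℂ H] [CompleteSpace H]
    (P : Set (FreeAlgebra ℂ (Fin n))) (T : Fin n → H →L[ℂ] H) :
    subTensor (DSpace T) (subspaceN P) →L[ℂ] subTensor (DStarSpace T) (subspaceN P) :=
  (subTensor (DStarSpace T) (subspaceN P)).orthogonalProjectionOnto ∘L charFun T ∘L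
    (subTensor (DSpace T) (subspaceN P)).subtypeL

/-- The inclusion of the first summand of the Hilbert space `E ⊕ F`. -/
def inlL (E F : Type*) [NormedAddCommGroup E] [InnerProductSpace ℂ E] [NormedAddCommGroup F]
    [InnerProductSpace ℂ F] : E →L[ℂ] WithLp 2 (E × F) :=
  (WithLp.prodContinuousLinearEquiv 2 ℂ E F).symm.toContinuousLinearMap ∘L
    ContinuousLinearMap.inl ℂ E F

/-- The inclusion of the second summand of the Hilbert space `E ⊕ F`. -/
def inrL (E F : Type*) [NormedAddCommGroup E] [InnerProductSpace ℂ E] [NormedAddCommGroup F]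
    [InnerProductSpace ℂ F] : F →L[ℂ] WithLp 2 (E × F) :=
  (WithLp.prodContinuousLinearEquiv 2 ℂ E F).symm.toContinuousLinearMap ∘L
    ContinuousLinearMap.inr ℂ E F

/-- The block diagonal operator `diag(Θ, I_{N ⊗ G})` from `N ⊗ (E ⊕ G) = (N ⊗ E) ⊕ (N ⊗ G)` to
`N ⊗ (F ⊕ G) = (N ⊗ F) ⊕ (N ⊗ G)`. -/
def diagId {N : Submodule ℂ (Fock n)} (Θ : subTensor E N →L[ℂ] subTensor F N)
    (G : Type*) [NormedAddCommGroup G] [InnerProductSpace ℂ G] :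
    subTensor (WithLp 2 (E × G)) N →L[ℂ] subTensor (WithLp 2 (F × G)) N :=
  idTensorOn N (inlL F G) ∘L Θ ∘L idTensorOn N (WithLp.fstL 2 ℂ E G) +
    idTensorOn N (inrL F G) ∘L idTensorOn N (WithLp.sndL 2 ℂ E G)

/-- `Θ` coincides with `Θ'`: there are unitaries `W : E → E'` and `W_* : F → F'` such that
`(I_N ⊗ W_*) Θ = Θ' (I_N ⊗ W)`. -/
def Coincides {N : Submodule ℂ (Fock n)}
    {E' : Type*} [NormedAddCommGroup E'] [InnerProductSpace ℂ E']
    {F' : Type*} [NormedAddCommGroup F'] [InnerProductSpace ℂ F']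
    (Θ : subTensor E N →L[ℂ] subTensor F N) (Θ' : subTensor E' N →L[ℂ] subTensor F' N) : Prop :=
  ∃ (W : E ≃ₗᵢ[ℂ] E') (Ws : F ≃ₗᵢ[ℂ] F'),
    idTensorOn N (Ws : F →L[ℂ] F') ∘L Θ = Θ' ∘L idTensorOn N (W : E →L[ℂ] E')

end Variety

section Triangular

/-- The Hilbert space direct sum `H₁ ⊕ H₀ ⊕ H₂`. -/
abbrev Sum3 (H₁ H₀ H₂ : Type*) : Type _ := WithLp 2 (H₁ × WithLp 2 (H₀ × H₂))

variable {H₁ H₀ H₂ : Type*}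
  [NormedAddCommGroup H₁] [InnerProductSpace ℂ H₁]
  [NormedAddCommGroup H₀] [InnerProductSpace ℂ H₀]
  [NormedAddCommGroup H₂] [InnerProductSpace ℂ H₂]

/-- `T` is the upper triangular operator matrix with rows `(S, X, Y)`, `(0, N, Z)`, `(0, 0, C)`. -/
def IsUpperTriangular (T : Sum3 H₁ H₀ H₂ →L[ℂ] Sum3 H₁ H₀ H₂)
    (S : H₁ →L[ℂ] H₁) (X : H₀ →L[ℂ] H₁) (Y : H₂ →L[ℂ] H₁)
    (N : H₀ →L[ℂ] H₀) (Z : H₂ →L[ℂ] H₀) (C : H₂ →L[ℂ] H₂) : Prop :=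
  ∀ (h₁ : H₁) (h₀ : H₀) (h₂ : H₂),
    T (WithLp.toLp 2 (h₁, WithLp.toLp 2 (h₀, h₂))) =
      WithLp.toLp 2 (S h₁ + X h₀ + Y h₂, WithLp.toLp 2 (N h₀ + Z h₂, C h₂))

end Triangular

end NCVariety

end

open NCVariety

universe u

/-! The characteristic function is the transfer operator of a unitary colligation. The Julia
operator of the row `T` is the unitary `(h, f) ↦ (T* h + D_T f, D_{T*} h - T f)` from `H ⊕ 𝒟_T` to
`H^n ⊕ 𝒟_{T*}`. Started at state `0` on the empty word and fed with `f`, it produces states indexed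
by words, and its outputs are the values of `Θ_T f` (`charFun_isTransfer`). The statement thus
becomes one about colligations.

Two facts about colligations carry the argument. A minimal colligation is determined by its state
map up to unitaries on the input and output spaces (`Colligation.IsMinimal.exists_unitary`), and
Julia colligations are minimal. Moreover, a block triangular contraction is the state map of a
minimal cascade of given minimal colligations of its diagonal entries, connected through the Julia
unitary of a further contraction `A` (`exists_cascade`); this is the parametrization of the
off-diagonal entry of a triangular contraction.

Since `T` is upper triangular, `T*` is lower triangular with diagonal `S*`, `N*`, `C*`. Two
applications of `exists_cascade`, with contractions `A` and `B`, make it the state map of a cascade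
of the Julia colligations of `S`, `N`, `C`. By uniqueness this cascade is the Julia colligation of
`T` up to unitaries. Signals pass through a cascade one stage after the other, so its transfer
operator is the product of those of the stages (`IsTransfer.eq_of_cascade`). The Julia unitaries of
`A` and `B`, extended by an identity and rebracketed, are `τ₁` and `τ₂`, and the auxiliary spaces
are made of the defect spaces of `A` and `B`.

This factors `Θ_T` on the full Fock space. To pass to `𝒩`, note that the right creation operators
commute with `F_n^∞`, hence leave `ℳ_J` invariant. All factors are built from them and from
operators `I ⊗ A`, so they preserve the complements of `𝒩 ⊗ E`; on such operators compression is
multiplicative (`compress_comp`). -/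

noncomputable section

namespace NCVariety

/-! ### Unitary colligations and uniqueness of minimal ones -/

section Colligation

variable {H E K F : Type*}
  [NormedAddCommGroup H] [InnerProductSpace ℂ H] [NormedAddCommGroup E] [InnerProductSpace ℂ E]
  [NormedAddCommGroup K] [InnerProductSpace ℂ K] [NormedAddCommGroup F] [InnerProductSpace ℂ F]

/-- A unitary colligation with state spaces `H` and `K`, input space `E` and output space `F`. -/
abbrev Colligation (H E K F : Type*)
    [NormedAddCommGroup H] [InnerProductSpace ℂ H] [NormedAddCommGroup E] [InnerProductSpace ℂ E]
    [NormedAddCommGroup K] [InnerProductSpace ℂ K] [NormedAddCommGroup F]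
    [InnerProductSpace ℂ F] : Type _ :=
  WithLp 2 (H × E) ≃ₗᵢ[ℂ] WithLp 2 (K × F)

/-- A colligation is minimal if neither its input space nor its output space contains a nonzero
vector that is decoupled from the state. -/
structure Colligation.IsMinimal (U : Colligation H E K F) : Prop where
  input : ∀ e, (U (WithLp.toLp 2 (0, e))).fst = 0 → e = 0
  output : ∀ f, (U.symm (WithLp.toLp 2 (0, f))).fst = 0 → f = 0

theorem Colligation.IsMinimal.symm {U : Colligation H E K F} (hU : U.IsMinimal) :
    Colligation.IsMinimal (H := K) (K := H) U.symm :=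
  ⟨hU.output, hU.input⟩

/-- The map from states to states of a colligation. -/
def Colligation.stateMap (U : Colligation H E K F) : H →L[ℂ] K :=
  WithLp.fstL 2 ℂ K F ∘L (U : WithLp 2 (H × E) →L[ℂ] WithLp 2 (K × F)) ∘L inlL H E

/-- The map from states to outputs of a colligation. -/
def Colligation.outMap (U : Colligation H E K F) : H →L[ℂ] F :=
  WithLp.sndL 2 ℂ K F ∘L (U : WithLp 2 (H × E) →L[ℂ] WithLp 2 (K × F)) ∘L inlL H E

theorem Colligation.stateMap_apply (U : Colligation H E K F) (h : H) :
    U.stateMap h = (U (WithLp.toLp 2 (h, 0))).fst := rfl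

theorem Colligation.outMap_apply (U : Colligation H E K F) (h : H) :
    U.outMap h = (U (WithLp.toLp 2 (h, 0))).snd := rfl

theorem Colligation.apply_state (U : Colligation H E K F) (h : H) :
    U (WithLp.toLp 2 (h, 0)) = WithLp.toLp 2 (U.stateMap h, U.outMap h) := rfl

theorem Colligation.norm_stateMap_outMap (U : Colligation H E K F) (h : H) :
    ‖U.stateMap h‖ ^ 2 + ‖U.outMap h‖ ^ 2 = ‖h‖ ^ 2 := by
  have := WithLp.prod_norm_sq_eq_of_L2 (U (WithLp.toLp 2 (h, 0)))
  rw [U.norm_map, WithLp.prod_norm_sq_eq_of_L2] at this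
  simpa [U.stateMap_apply, U.outMap_apply] using this.symm

theorem inner_isometryEquiv_symm {A B : Type*} [NormedAddCommGroup A] [InnerProductSpace ℂ A]
    [NormedAddCommGroup B] [InnerProductSpace ℂ B] (U : A ≃ₗᵢ[ℂ] B) (x : A) (y : B) :
    ⟪U x, y⟫_ℂ = ⟪x, U.symm y⟫_ℂ := by
  rw [← U.inner_map_map x, U.apply_symm_apply]

theorem Colligation.inner_outMap (U : Colligation H E K F) (h : H) (f : F) :
    ⟪U.outMap h, f⟫_ℂ = ⟪h, (U.symm (WithLp.toLp 2 (0, f))).fst⟫_ℂ := by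
  have := inner_isometryEquiv_symm U (WithLp.toLp 2 (h, 0)) (WithLp.toLp 2 (0, f))
  simpa [WithLp.prod_inner_apply, U.outMap_apply] using this

theorem Colligation.inner_stateMap (U : Colligation H E K F) (h : H) (k : K) :
    ⟪U.stateMap h, k⟫_ℂ = ⟪h, Colligation.stateMap (H := K) (K := H) U.symm k⟫_ℂ := by
  have := inner_isometryEquiv_symm U (WithLp.toLp 2 (h, 0)) (WithLp.toLp 2 (k, 0))
  simpa [WithLp.prod_inner_apply, Colligation.stateMap_apply] using this

theorem denseRange_of_inner {A B : Type*} [NormedAddCommGroup A] [InnerProductSpace ℂ A]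
    [NormedAddCommGroup B] [InnerProductSpace ℂ B] [CompleteSpace B] (f : A →L[ℂ] B)
    (h : ∀ b, (∀ a, ⟪f a, b⟫_ℂ = 0) → b = 0) : DenseRange f := by
  have h1 : (LinearMap.range f.toLinearMap).topologicalClosure = ⊤ := by
    rw [Submodule.topologicalClosure_eq_top_iff, Submodule.eq_bot_iff]
    intro b hb
    exact h b fun a => (Submodule.mem_orthogonal _ _).1 hb _ ⟨a, rfl⟩
  have h2 := (Submodule.dense_iff_topologicalClosure_eq_top).2 h1
  exact h2

/-- By `inner_outMap` the adjoint of the output map is `f ↦ (U⁻¹ (0, f)).fst`. Minimality at the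
output is injectivity of this adjoint, which amounts to density of the range. -/
theorem Colligation.IsMinimal.denseRange_outMap [CompleteSpace F] {U : Colligation H E K F}
    (hU : U.IsMinimal) : DenseRange U.outMap := by
  refine denseRange_of_inner _ fun f hf => hU.output f ?_
  refine ext_inner_left ℂ fun h => ?_
  rw [← U.inner_outMap, hf, inner_zero_right]

/-- The state map of `U⁻¹` is the adjoint of that of `U`, so one determines the other. This lets the
argument for outputs be reused for inputs. -/
theorem Colligation.stateMap_symm_congr {E' F' : Type*} [NormedAddCommGroup E']
    [InnerProductSpace ℂ E'] [NormedAddCommGroup F'] [InnerProductSpace ℂ F']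
    {U : Colligation H E K F} {V : Colligation H E' K F'}
    (h : ∀ x, U.stateMap x = V.stateMap x) (k : K) :
    Colligation.stateMap (H := K) (K := H) U.symm k =
      Colligation.stateMap (H := K) (K := H) V.symm k := by
  refine ext_inner_left ℂ fun x => ?_
  rw [← U.inner_stateMap, ← V.inner_stateMap, h]

/-- Unitarity gives `‖out h‖² = ‖h‖² - ‖state h‖²`, so the norms of outputs depend on the state map
alone. Matching the outputs of `U` and `V` is therefore isometric between dense ranges and extends
to a unitary. -/
theorem Colligation.IsMinimal.exists_output_unitary [CompleteSpace F] {E' F' : Type*}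
    [NormedAddCommGroup E'] [InnerProductSpace ℂ E'] [NormedAddCommGroup F']
    [InnerProductSpace ℂ F'] [CompleteSpace F']
    {U : Colligation H E K F} {V : Colligation H E' K F'} (hU : U.IsMinimal) (hV : V.IsMinimal)
    (h : ∀ x, U.stateMap x = V.stateMap x) :
    ∃ W : F ≃ₗᵢ[ℂ] F', ∀ x, W (U.outMap x) = V.outMap x := by
  have hn : ∀ x, ‖V.outMap x‖ = ‖U.outMap x‖ := fun x => by
    have h1 := U.norm_stateMap_outMap x
    have h2 := V.norm_stateMap_outMap x
    rw [h x] at h1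
    exact (sq_eq_sq₀ (norm_nonneg _) (norm_nonneg _)).1 (by linarith)
  exact ⟨(LinearEquiv.refl ℂ H).extendOfIsometry U.outMap.toLinearMap V.outMap.toLinearMap
    hU.denseRange_outMap hV.denseRange_outMap hn, fun x =>
    (LinearEquiv.refl ℂ H).extendOfIsometry_eq U.outMap.toLinearMap V.outMap.toLinearMap
      hU.denseRange_outMap hV.denseRange_outMap hn x⟩

theorem toLp_zero_eq_sub {H E : Type*} [NormedAddCommGroup H] [NormedAddCommGroup E] (h : H)
    (e : E) :
    WithLp.toLp 2 ((0 : H), e) = WithLp.toLp 2 (h, e) - WithLp.toLp 2 (h, 0) := by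
  rw [← WithLp.toLp_sub]
  simp

theorem toLp_eq_add {H E : Type*} [NormedAddCommGroup H] [NormedAddCommGroup E] (h : H) (e : E) :
    WithLp.toLp 2 (h, e) = WithLp.toLp 2 (h, 0) + WithLp.toLp 2 (0, e) := by
  rw [← WithLp.toLp_add]
  simp

/-- Minimal colligations with the same state map agree up to unitary changes of the input and
output spaces. -/
theorem Colligation.IsMinimal.exists_unitary [CompleteSpace E] [CompleteSpace F] {E' F' : Type*}
    [NormedAddCommGroup E'] [InnerProductSpace ℂ E'] [CompleteSpace E'] [NormedAddCommGroup F']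
    [InnerProductSpace ℂ F'] [CompleteSpace F']
    {U : Colligation H E K F} {V : Colligation H E' K F'} (hU : U.IsMinimal) (hV : V.IsMinimal)
    (h : ∀ x, U.stateMap x = V.stateMap x) :
    ∃ (W : E ≃ₗᵢ[ℂ] E') (Ws : F ≃ₗᵢ[ℂ] F'), ∀ x e, V (WithLp.toLp 2 (x, W e)) =
      WithLp.toLp 2 ((U (WithLp.toLp 2 (x, e))).fst, Ws (U (WithLp.toLp 2 (x, e))).snd) := by
  obtain ⟨Ws, hWs⟩ := hU.exists_output_unitary hV h
  obtain ⟨W, hW⟩ := Colligation.IsMinimal.exists_output_unitary hU.symm hV.symm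
    (Colligation.stateMap_symm_congr h)
  refine ⟨W, Ws, ?_⟩
  have h0 : ∀ x, V (WithLp.toLp 2 (x, 0)) =
      WithLp.toLp 2 ((U (WithLp.toLp 2 (x, 0))).fst, Ws (U (WithLp.toLp 2 (x, 0))).snd) := by
    intro x
    rw [U.apply_state, V.apply_state, ← h, ← hWs]
    rfl
  let Q : WithLp 2 (K × F) ≃ₗᵢ[ℂ] WithLp 2 (K × F') :=
    LinearIsometryEquiv.withLpProdCongr 2 (LinearIsometryEquiv.refl ℂ K) Ws
  have hQ : ∀ x e, WithLp.toLp 2 ((U (WithLp.toLp 2 (x, e))).fst,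
      Ws (U (WithLp.toLp 2 (x, e))).snd) = Q (U (WithLp.toLp 2 (x, e))) := fun x e => rfl
  simp only [hQ] at h0 ⊢
  have key : ∀ e, V (WithLp.toLp 2 (0, W e)) = Q (U (WithLp.toLp 2 (0, e))) := by
    intro e
    refine (Colligation.IsMinimal.denseRange_outMap hU.symm).induction_on e ?_ fun k => ?_
    · refine isClosed_eq ?_ ?_
      · exact V.continuous.comp ((inrL H E').continuous.comp W.continuous)
      · exact Q.continuous.comp (U.continuous.comp (inrL H E).continuous)
    -- For `e` the output of `U⁻¹` at `(k, 0)`, one has `(0, e) = U⁻¹ (k, 0) - (s, 0)`. Hence `U (0,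
    -- e) = (k, 0) - U (s, 0)`, and likewise for `V` with the same `s`, which reduces the claim to
    -- `h0`.
    · have e1 := Colligation.apply_state (H := K) (K := H) U.symm k
      have e2 := Colligation.apply_state (H := K) (K := H) V.symm k
      rw [← hW] at e2
      rw [Colligation.stateMap_symm_congr h] at e1
      set s := Colligation.stateMap (H := K) (K := H) V.symm k
      rw [toLp_zero_eq_sub s, toLp_zero_eq_sub s (Colligation.outMap (H := K) (K := H) U.symm k), map_sub, map_sub, map_sub,
        ← e1, ← e2, h0, V.apply_symm_apply, U.apply_symm_apply]
      congr 1
      change _ = WithLp.toLp 2 (k, Ws 0)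
      rw [map_zero]
  intro x e
  rw [toLp_eq_add x, toLp_eq_add x e, map_add, map_add, map_add, h0, key]

end Colligation

/-! ### The Julia colligation of a contraction -/

section Julia

variable {E : Type*} [NormedAddCommGroup E] [InnerProductSpace ℂ E] [CompleteSpace E]
  {F : Type*} [NormedAddCommGroup F] [InnerProductSpace ℂ F] [CompleteSpace F]

theorem mem_defectSpace_adjoint (A : E →L[ℂ] F) (hA : ‖A‖ ≤ 1) {x : E} (hx : x ∈ defectSpace A) :
    A x ∈ defectSpace (ContinuousLinearMap.adjoint A) := by
  have h : defectSpace A ≤ (defectSpace (ContinuousLinearMap.adjoint A)).comap A.toLinearMap := by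
    refine Submodule.topologicalClosure_minimal _ ?_ ?_
    · rintro _ ⟨y, rfl⟩
      exact Submodule.le_topologicalClosure _ ⟨A y, (defect_intertwine A hA y).symm⟩
    · exact (Submodule.isClosed_topologicalClosure _).preimage A.continuous
  exact h hx

theorem adjoint_mem_defectSpace (A : E →L[ℂ] F) (hA : ‖A‖ ≤ 1) {y : F}
    (hy : y ∈ defectSpace (ContinuousLinearMap.adjoint A)) :
    ContinuousLinearMap.adjoint A y ∈ defectSpace A := by
  have h := mem_defectSpace_adjoint (ContinuousLinearMap.adjoint A) (by simpa using hA) hy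
  rwa [ContinuousLinearMap.adjoint_adjoint] at h

theorem defectOp_mem (A : E →L[ℂ] F) (x : E) : defectOp A x ∈ defectSpace A :=
  Submodule.le_topologicalClosure _ ⟨x, rfl⟩

/-- `D_A` is self-adjoint, so its kernel is orthogonal to the closure of its range. -/
theorem eq_zero_of_defectOp_eq_zero (A : E →L[ℂ] F) (x : defectSpace A)
    (hx : defectOp A (x : E) = 0) : x = 0 := by
  have h : (x : E) ∈ (defectSpace A)ᗮ := by
    change (x : E) ∈ (LinearMap.range (defectOp A).toLinearMap).topologicalClosureᗮ
    rw [Submodule.orthogonal_closure, Submodule.mem_orthogonal]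
    rintro _ ⟨y, rfl⟩
    exact (defect_symm A y x).trans (by rw [hx, inner_zero_right])
  exact Subtype.ext ((Submodule.mem_bot ℂ).1
    ((Submodule.inf_orthogonal_eq_bot (defectSpace A)).le ⟨x.2, h⟩))

/-- The linear equivalence underlying the Julia colligation. -/
def juliaEquiv (A : E →L[ℂ] F) (hA : ‖A‖ ≤ 1) :
    WithLp 2 (F × defectSpace A) ≃ₗ[ℂ]
      WithLp 2 (E × defectSpace (ContinuousLinearMap.adjoint A)) where
  toFun x := WithLp.toLp 2 (ContinuousLinearMap.adjoint A x.fst + defectOp A (x.snd : E),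
    ⟨defectOp (ContinuousLinearMap.adjoint A) x.fst - A x.snd,
      sub_mem (defectOp_mem _ _) (mem_defectSpace_adjoint A hA x.snd.2)⟩)
  invFun y := WithLp.toLp 2 (A y.fst + defectOp (ContinuousLinearMap.adjoint A) (y.snd : F),
    ⟨defectOp A y.fst - ContinuousLinearMap.adjoint A y.snd,
      sub_mem (defectOp_mem _ _) (adjoint_mem_defectSpace A hA y.snd.2)⟩)
  map_add' x y := by
    refine (WithLp.ofLp_injective 2) (Prod.ext ?_ (Subtype.ext ?_))
    · simp
      abel
    · simp
      abel
  map_smul' c x := by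
    refine (WithLp.ofLp_injective 2) (Prod.ext ?_ (Subtype.ext ?_))
    · simp
    · simp [smul_sub]
  left_inv x := by
    -- The diagonal terms cancel by `D_A² = I - A* A` and its analogue for `A*`, the mixed ones by
    -- `A D_A = D_{A*} A` and its analogue.
    have hA' : ‖ContinuousLinearMap.adjoint A‖ ≤ 1 := by simpa using hA
    have e1 := defect_sq _ hA' x.fst
    have e2 := defect_sq _ hA (x.snd : E)
    have e3 := defect_intertwine _ hA (x.snd : E)
    have e4 := defect_intertwine _ hA' x.fst
    rw [ContinuousLinearMap.adjoint_adjoint] at e1 e4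
    refine (WithLp.ofLp_injective 2) (Prod.ext ?_ (Subtype.ext ?_))
    · simp [e1, e3]
    · simp [e2, e4]
  right_inv y := by
    have hA' : ‖ContinuousLinearMap.adjoint A‖ ≤ 1 := by simpa using hA
    have e1 := defect_sq _ hA' (y.snd : F)
    have e2 := defect_sq _ hA y.fst
    have e3 := defect_intertwine _ hA y.fst
    have e4 := defect_intertwine _ hA' (y.snd : F)
    rw [ContinuousLinearMap.adjoint_adjoint] at e1 e4
    refine (WithLp.ofLp_injective 2) (Prod.ext ?_ (Subtype.ext ?_))
    · simp [e2, e4]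
    · simp [e1, e3]

/-- The Julia colligation `(h, f) ↦ (A* h + D_A f, D_{A*} h - A f)` of a contraction `A`. -/
def julia (A : E →L[ℂ] F) (hA : ‖A‖ ≤ 1) :
    Colligation F (defectSpace A) E (defectSpace (ContinuousLinearMap.adjoint A)) where
  toLinearEquiv := juliaEquiv A hA
  norm_map' x := by
    have h := WithLp.prod_norm_sq_eq_of_L2 (juliaEquiv A hA x)
    have h' := julia_norm A hA x.fst (x.snd : E)
    refine (sq_eq_sq₀ (norm_nonneg _) (norm_nonneg _)).1 (h.trans (h'.trans ?_))
    rw [WithLp.prod_norm_sq_eq_of_L2 x, Submodule.coe_norm]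

theorem julia_fst (A : E →L[ℂ] F) (hA : ‖A‖ ≤ 1) (h : F) (f : defectSpace A) :
    (julia A hA (WithLp.toLp 2 (h, f))).fst =
      ContinuousLinearMap.adjoint A h + defectOp A (f : E) := rfl

theorem julia_symm_fst (A : E →L[ℂ] F) (hA : ‖A‖ ≤ 1) (k : E)
    (g : defectSpace (ContinuousLinearMap.adjoint A)) :
    ((julia A hA).symm (WithLp.toLp 2 (k, g))).fst =
      A k + defectOp (ContinuousLinearMap.adjoint A) (g : F) := rfl

theorem julia_stateMap (A : E →L[ℂ] F) (hA : ‖A‖ ≤ 1) (h : F) :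
    (julia A hA).stateMap h = ContinuousLinearMap.adjoint A h := by
  rw [Colligation.stateMap_apply, julia_fst]
  simp

/-- From state `0` the Julia colligation and its inverse move to `D_A e` and `D_{A*} f`. Both defect
operators are injective on their defect spaces; this is why the inputs and outputs are restricted to
those spaces. -/
theorem julia_isMinimal (A : E →L[ℂ] F) (hA : ‖A‖ ≤ 1) : (julia A hA).IsMinimal := by
  refine ⟨fun e he => eq_zero_of_defectOp_eq_zero A e ?_,
    fun f hf => eq_zero_of_defectOp_eq_zero _ f ?_⟩
  · rw [julia_fst] at he
    simpa using he
  · rw [julia_symm_fst] at hf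
    simpa using hf

end Julia

/-! ### Cascades and block triangular contractions -/

section Cascade

variable {H₁ E₁ K₁ F₁ H₂ E₂ K₂ F₂ G G' : Type*}
  [NormedAddCommGroup H₁] [InnerProductSpace ℂ H₁] [NormedAddCommGroup E₁] [InnerProductSpace ℂ E₁]
  [NormedAddCommGroup K₁] [InnerProductSpace ℂ K₁] [NormedAddCommGroup F₁] [InnerProductSpace ℂ F₁]
  [NormedAddCommGroup H₂] [InnerProductSpace ℂ H₂] [NormedAddCommGroup E₂] [InnerProductSpace ℂ E₂]
  [NormedAddCommGroup K₂] [InnerProductSpace ℂ K₂] [NormedAddCommGroup F₂] [InnerProductSpace ℂ F₂]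
  [NormedAddCommGroup G] [InnerProductSpace ℂ G] [NormedAddCommGroup G'] [InnerProductSpace ℂ G']

/-- The exchange of the two middle summands of `(A ⊕ B) ⊕ (C ⊕ D)`. -/
def exchange (A B C D : Type*)
    [NormedAddCommGroup A] [InnerProductSpace ℂ A] [NormedAddCommGroup B] [InnerProductSpace ℂ B]
    [NormedAddCommGroup C] [InnerProductSpace ℂ C] [NormedAddCommGroup D] [InnerProductSpace ℂ D] :
    WithLp 2 (WithLp 2 (A × B) × WithLp 2 (C × D)) ≃ₗᵢ[ℂ]
      WithLp 2 (WithLp 2 (A × C) × WithLp 2 (B × D)) where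
  toFun x := WithLp.toLp 2 (WithLp.toLp 2 (x.fst.fst, x.snd.fst),
    WithLp.toLp 2 (x.fst.snd, x.snd.snd))
  invFun x := WithLp.toLp 2 (WithLp.toLp 2 (x.fst.fst, x.snd.fst),
    WithLp.toLp 2 (x.fst.snd, x.snd.snd))
  map_add' _ _ := rfl
  map_smul' _ _ := rfl
  left_inv _ := rfl
  right_inv _ := rfl
  norm_map' x := by
    refine (sq_eq_sq₀ (norm_nonneg _) (norm_nonneg _)).1 ?_
    rw [WithLp.prod_norm_sq_eq_of_L2 x, WithLp.prod_norm_sq_eq_of_L2 x.fst,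
      WithLp.prod_norm_sq_eq_of_L2 x.snd]
    change ‖WithLp.toLp 2 (WithLp.toLp 2 (x.fst.fst, x.snd.fst),
      WithLp.toLp 2 (x.fst.snd, x.snd.snd))‖ ^ 2 = _
    simp only [WithLp.prod_norm_sq_eq_of_L2]
    exact add_add_add_comm _ _ _ _

/-- The connection of two colligations through a unitary `τ` that turns the output of the first
one, together with an additional input, into the input of the second one and an additional
output. -/
def cascade (U₁ : Colligation H₁ E₁ K₁ F₁) (U₂ : Colligation H₂ E₂ K₂ F₂)
    (τ : Colligation F₁ G E₂ G') :
    Colligation (WithLp 2 (H₁ × H₂)) (WithLp 2 (E₁ × G)) (WithLp 2 (K₁ × K₂))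
      (WithLp 2 (F₂ × G')) :=
  (exchange H₁ H₂ E₁ G).trans <|
  (LinearIsometryEquiv.withLpProdCongr 2 U₁ (LinearIsometryEquiv.refl ℂ _)).trans <|
  (exchange K₁ F₁ H₂ G).trans <|
  (LinearIsometryEquiv.withLpProdCongr 2 (LinearIsometryEquiv.withLpProdComm 2 ℂ K₁ H₂) τ).trans <|
  (exchange H₂ K₁ E₂ G').trans <|
  (LinearIsometryEquiv.withLpProdCongr 2 U₂ (LinearIsometryEquiv.refl ℂ _)).trans <|
  (exchange K₂ F₂ K₁ G').trans <|
  LinearIsometryEquiv.withLpProdCongr 2 (LinearIsometryEquiv.withLpProdComm 2 ℂ K₂ K₁)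
    (LinearIsometryEquiv.refl ℂ _)

theorem cascade_apply (U₁ : Colligation H₁ E₁ K₁ F₁) (U₂ : Colligation H₂ E₂ K₂ F₂)
    (τ : Colligation F₁ G E₂ G') {h₁ : H₁} {h₂ : H₂} {e₁ : E₁} {g : G} {k₁ : K₁} {f₁ : F₁} {e₂ : E₂}
    {g' : G'} {k₂ : K₂} {f₂ : F₂} (h1 : U₁ (WithLp.toLp 2 (h₁, e₁)) = WithLp.toLp 2 (k₁, f₁))
    (ht : τ (WithLp.toLp 2 (f₁, g)) = WithLp.toLp 2 (e₂, g'))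
    (h2 : U₂ (WithLp.toLp 2 (h₂, e₂)) = WithLp.toLp 2 (k₂, f₂)) :
    cascade U₁ U₂ τ (WithLp.toLp 2 (WithLp.toLp 2 (h₁, h₂), WithLp.toLp 2 (e₁, g))) =
      WithLp.toLp 2 (WithLp.toLp 2 (k₁, k₂), WithLp.toLp 2 (f₂, g')) := by
  have e1 : cascade U₁ U₂ τ (WithLp.toLp 2 (WithLp.toLp 2 (h₁, h₂), WithLp.toLp 2 (e₁, g))) =
    (let y₁ := U₁ (WithLp.toLp 2 (h₁, e₁))
     let z := τ (WithLp.toLp 2 (y₁.snd, g))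
     let y₂ := U₂ (WithLp.toLp 2 (h₂, z.fst))
     WithLp.toLp 2 (WithLp.toLp 2 (y₁.fst, y₂.fst), WithLp.toLp 2 (y₂.snd, z.snd))) := rfl
  rw [e1]
  simp [h1, ht, h2]

theorem cascade_symm_apply (U₁ : Colligation H₁ E₁ K₁ F₁) (U₂ : Colligation H₂ E₂ K₂ F₂)
    (τ : Colligation F₁ G E₂ G') {h₁ : H₁} {h₂ : H₂} {e₁ : E₁} {g : G} {k₁ : K₁} {f₁ : F₁} {e₂ : E₂}
    {g' : G'} {k₂ : K₂} {f₂ : F₂} (h2 : U₂.symm (WithLp.toLp 2 (k₂, f₂)) = WithLp.toLp 2 (h₂, e₂))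
    (ht : τ.symm (WithLp.toLp 2 (e₂, g')) = WithLp.toLp 2 (f₁, g))
    (h1 : U₁.symm (WithLp.toLp 2 (k₁, f₁)) = WithLp.toLp 2 (h₁, e₁)) :
    (cascade U₁ U₂ τ).symm (WithLp.toLp 2 (WithLp.toLp 2 (k₁, k₂), WithLp.toLp 2 (f₂, g'))) =
      WithLp.toLp 2 (WithLp.toLp 2 (h₁, h₂), WithLp.toLp 2 (e₁, g)) := by
  rw [LinearIsometryEquiv.symm_apply_eq] at *
  exact (cascade_apply U₁ U₂ τ h1.symm ht.symm h2.symm).symm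

/-- Suppose an input `(e₁, g)` does not affect the states. Minimality of `U₁` gives `e₁ = 0`, so `τ`
receives `(0, g)`; minimality of `U₂` makes the signal sent to `U₂` vanish, and minimality of `τ`
gives `g = 0`. Outputs are treated by running the cascade backwards. -/
theorem cascade_isMinimal {U₁ : Colligation H₁ E₁ K₁ F₁} {U₂ : Colligation H₂ E₂ K₂ F₂}
    {τ : Colligation F₁ G E₂ G'} (h₁ : U₁.IsMinimal) (h₂ : U₂.IsMinimal) (hτ : τ.IsMinimal) :
    (cascade U₁ U₂ τ).IsMinimal := by
  constructor
  · intro e he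
    have h := cascade_apply U₁ U₂ τ (h₁ := 0) (h₂ := 0) (e₁ := e.fst) (g := e.snd) rfl rfl rfl
    have h' : (cascade U₁ U₂ τ (WithLp.toLp 2 (0, e))).fst = _ := congrArg WithLp.fst h
    rw [he] at h'
    have a1 : e.fst = 0 := h₁.input _ (congrArg WithLp.fst h').symm
    have a2 : (τ (WithLp.toLp 2 ((U₁ (WithLp.toLp 2 (0, e.fst))).snd, e.snd))).fst = 0 :=
      h₂.input _ (congrArg WithLp.snd h').symm
    rw [a1, show U₁ (WithLp.toLp 2 (0, 0)) = 0 from map_zero _] at a2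
    have a3 : e.snd = 0 := hτ.input _ a2
    exact (WithLp.ofLp_injective 2) (Prod.ext a1 a3)
  · intro f hf
    have h := cascade_symm_apply U₁ U₂ τ (k₁ := 0) (k₂ := 0) (f₂ := f.fst) (g' := f.snd) rfl rfl rfl
    have h' : ((cascade U₁ U₂ τ).symm (WithLp.toLp 2 (0, f))).fst = _ := congrArg WithLp.fst h
    rw [hf] at h'
    have a1 : f.fst = 0 := h₂.output _ (congrArg WithLp.snd h').symm
    have a2 : (τ.symm (WithLp.toLp 2 ((U₂.symm (WithLp.toLp 2 (0, f.fst))).snd, f.snd))).fst = 0 :=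
      h₁.output _ (congrArg WithLp.fst h').symm
    rw [a1, show U₂.symm (WithLp.toLp 2 (0, 0)) = 0 from map_zero _] at a2
    have a3 : f.snd = 0 := hτ.output _ a2
    exact (WithLp.ofLp_injective 2) (Prod.ext a1 a3)

/-- A Douglas type factorization: the norm inequality makes `f x ↦ g x` a well-defined contraction
on a dense subspace. -/
theorem exists_factor_of_norm_le {A B C : Type*} [NormedAddCommGroup A] [InnerProductSpace ℂ A]
    [NormedAddCommGroup B] [InnerProductSpace ℂ B] [NormedAddCommGroup C] [InnerProductSpace ℂ C]
    [CompleteSpace C] (f : A →L[ℂ] B) (g : A →L[ℂ] C) (hf : DenseRange f)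
    (h : ∀ x, ‖g x‖ ≤ ‖f x‖) : ∃ L : B →L[ℂ] C, ‖L‖ ≤ 1 ∧ ∀ x, L (f x) = g x :=
  ⟨g.toLinearMap.extendOfNorm f.toLinearMap,
    LinearMap.opNorm_extendOfNorm_le (f := g.toLinearMap) (e := f.toLinearMap) hf zero_le_one
      (fun x => by rw [one_mul]; exact h x),
    fun x => LinearMap.extendOfNorm_eq (f := g.toLinearMap) (e := f.toLinearMap) hf
      ⟨1, fun x => by rw [one_mul]; exact h x⟩ x⟩

/-- A contraction `[[A₁, 0], [Z, A₂]]` is the state map of a minimal cascade of minimal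
colligations with state maps `A₁` and `A₂`. -/
theorem exists_cascade [CompleteSpace H₁] [CompleteSpace H₂] [CompleteSpace K₁] [CompleteSpace K₂]
    [CompleteSpace F₁] [CompleteSpace E₂] [CompleteSpace E₁]
    {U₁ : Colligation H₁ E₁ K₁ F₁} {U₂ : Colligation H₂ E₂ K₂ F₂}
    (h₁ : U₁.IsMinimal) (h₂ : U₂.IsMinimal)
    (M : WithLp 2 (H₁ × H₂) →L[ℂ] WithLp 2 (K₁ × K₂)) (hM : ‖M‖ ≤ 1)
    (hM₁ : ∀ x y, (M (WithLp.toLp 2 (x, y))).fst = U₁.stateMap x)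
    (hM₂ : ∀ y, (M (WithLp.toLp 2 (0, y))).snd = U₂.stateMap y) :
    ∃ (A : E₂ →L[ℂ] F₁) (hA : ‖A‖ ≤ 1), ∀ x, (cascade U₁ U₂ (julia A hA)).stateMap x = M x := by
  have hMn : ∀ x, ‖M x‖ ^ 2 ≤ ‖x‖ ^ 2 := fun x =>
    pow_le_pow_left₀ (norm_nonneg _) (by simpa using M.le_of_opNorm_le hM x) 2
  let Z : H₁ →L[ℂ] K₂ := WithLp.sndL 2 ℂ K₁ K₂ ∘L M ∘L inlL H₁ H₂
  have hZ : ∀ u v, (M (WithLp.toLp 2 (u, v))).snd = Z u + U₂.stateMap v := fun u v => by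
    rw [toLp_eq_add, map_add, WithLp.add_snd, hM₂]
    rfl
  -- The first column of `M` is a contraction, so `‖Z u‖² ≤ ‖u‖² - ‖A₁ u‖² = ‖out₁ u‖²` and `Z = L ∘
  -- out₁`. It remains to split off from `L` the map from the input of `U₂` to its state.
  obtain ⟨L, -, hL⟩ := exists_factor_of_norm_le U₁.outMap Z h₁.denseRange_outMap (fun u => by
    have a1 := hMn (WithLp.toLp 2 (u, 0))
    have a2 := U₁.norm_stateMap_outMap u
    rw [WithLp.prod_norm_sq_eq_of_L2, WithLp.prod_norm_sq_eq_of_L2, hM₁, hZ, map_zero,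
      add_zero] at a1
    simp only [WithLp.toLp_fst, WithLp.toLp_snd, norm_zero] at a1
    refine le_of_sq_le_sq ?_ (norm_nonneg _)
    linarith)
  let B : K₂ →L[ℂ] E₂ := Colligation.outMap (H := K₂) (K := H₂) U₂.symm
  have hB : ∀ k, ‖ContinuousLinearMap.adjoint L k‖ ≤ ‖B k‖ := by
    intro k
    set g := ContinuousLinearMap.adjoint L k with hg
    -- The first entry of `M* (k₁, k)` is `A₁* k₁ + out₁* (L* k)`, which is the state component of
    -- `U₁⁻¹ (k₁, g)`.
    have b1 : ∀ k₁, ContinuousLinearMap.adjoint M (WithLp.toLp 2 (k₁, k)) =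
        WithLp.toLp 2 ((U₁.symm (WithLp.toLp 2 (k₁, g))).fst,
          Colligation.stateMap (H := K₂) (K := H₂) U₂.symm k) := by
      intro k₁
      refine ext_inner_left ℂ fun x => ?_
      obtain ⟨u, v⟩ := x
      have c1 : ⟪u, (U₁.symm (WithLp.toLp 2 (k₁, g))).fst⟫_ℂ =
          ⟪U₁.stateMap u, k₁⟫_ℂ + ⟪U₁.outMap u, g⟫_ℂ := by
        have := inner_isometryEquiv_symm U₁ (WithLp.toLp 2 (u, 0)) (WithLp.toLp 2 (k₁, g))
        rw [U₁.apply_state, WithLp.prod_inner_apply, WithLp.prod_inner_apply] at this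
        simpa using this.symm
      rw [ContinuousLinearMap.adjoint_inner_right, WithLp.prod_inner_apply,
        WithLp.prod_inner_apply]
      change ⟪(M (WithLp.toLp 2 (u, v))).fst, k₁⟫_ℂ + ⟪(M (WithLp.toLp 2 (u, v))).snd, k⟫_ℂ =
        ⟪u, (U₁.symm (WithLp.toLp 2 (k₁, g))).fst⟫_ℂ +
          ⟪v, Colligation.stateMap (H := K₂) (K := H₂) U₂.symm k⟫_ℂ
      rw [hM₁, hZ, c1, ← U₂.inner_stateMap, inner_add_left, ← hL, hg,
        ContinuousLinearMap.adjoint_inner_right]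
      ring
    -- For `e` the output of `U₁⁻¹` at `(k₁, 0)`, this is contractivity of `M*` combined with
    -- unitarity of `U₁⁻¹` and `U₂⁻¹`; density of such `e` gives the rest.
    have b2 : ∀ e, ‖g‖ ^ 2 ≤ ‖e + (U₁.symm (WithLp.toLp 2 (0, g))).snd‖ ^ 2 + ‖B k‖ ^ 2 := by
      intro e
      refine (Colligation.IsMinimal.denseRange_outMap h₁.symm).induction_on e ?_ fun k₁ => ?_
      · exact isClosed_le (by fun_prop) (by fun_prop)
      · have d1 : ‖ContinuousLinearMap.adjoint M (WithLp.toLp 2 (k₁, k))‖ ^ 2 ≤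
            ‖WithLp.toLp 2 (k₁, k)‖ ^ 2 :=
          pow_le_pow_left₀ (norm_nonneg _)
            (((ContinuousLinearMap.adjoint M).le_of_opNorm_le
              ((ContinuousLinearMap.adjoint.norm_map M).trans_le hM) _).trans (one_mul _).le) 2
        have d2 := Colligation.norm_stateMap_outMap (H := K₂) (K := H₂) U₂.symm k
        have d3 := WithLp.prod_norm_sq_eq_of_L2 (U₁.symm (WithLp.toLp 2 (k₁, g)))
        have d4 : (U₁.symm (WithLp.toLp 2 (k₁, g))).snd =
            Colligation.outMap (H := K₁) (K := H₁) U₁.symm k₁ +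
              (U₁.symm (WithLp.toLp 2 (0, g))).snd := by
          rw [toLp_eq_add, map_add, WithLp.add_snd]
          rfl
        rw [U₁.symm.norm_map, WithLp.prod_norm_sq_eq_of_L2, d4] at d3
        rw [b1, WithLp.prod_norm_sq_eq_of_L2, WithLp.prod_norm_sq_eq_of_L2] at d1
        simp only [WithLp.toLp_fst, WithLp.toLp_snd] at d1 d3
        change _ ≤ _ + ‖Colligation.outMap (H := K₂) (K := H₂) U₂.symm k‖ ^ 2
        linarith
    -- This choice of `e` cancels the first term and leaves `‖L* k‖ ≤ ‖B k‖`.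
    have b3 := b2 (-(U₁.symm (WithLp.toLp 2 (0, g))).snd)
    rw [neg_add_cancel, norm_zero] at b3
    refine le_of_sq_le_sq ?_ (norm_nonneg _)
    linarith
  obtain ⟨A, hA, hAB⟩ := exists_factor_of_norm_le B (ContinuousLinearMap.adjoint L)
    (Colligation.IsMinimal.denseRange_outMap h₂.symm) hB
  -- Taking adjoints in `A B = L*` gives `L = B* A*`, where `B*` is the map from inputs to states of
  -- `U₂`. Thus `Z = B* A* out₁`, which is the corner of the cascade through the Julia unitary of
  -- `A`.
  have hAL : ∀ f, (U₂ (WithLp.toLp 2 (0, ContinuousLinearMap.adjoint A f))).fst = L f := by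
    intro f
    refine ext_inner_left ℂ fun k => ?_
    have := Colligation.inner_outMap (H := K₂) (K := H₂) U₂.symm k (ContinuousLinearMap.adjoint A f)
    rw [LinearIsometryEquiv.symm_symm] at this
    rw [← this, ContinuousLinearMap.adjoint_inner_right, ← ContinuousLinearMap.adjoint_inner_left L,
      ← hAB]
  refine ⟨A, hA, fun x => ?_⟩
  obtain ⟨u, v⟩ := x
  have h := cascade_apply U₁ U₂ (julia A hA) (h₁ := u) (h₂ := v) (e₁ := 0) (g := 0)
    (U₁.apply_state u) rfl rfl
  have h' : (cascade U₁ U₂ (julia A hA)).stateMap (WithLp.toLp 2 (u, v)) = _ :=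
    congrArg WithLp.fst h
  rw [h']
  refine (WithLp.ofLp_injective 2) (Prod.ext (hM₁ u v).symm ?_)
  change (U₂ (WithLp.toLp 2 (v, (julia A hA (WithLp.toLp 2 (U₁.outMap u, 0))).fst))).fst =
    (M (WithLp.toLp 2 (u, v))).snd
  rw [julia_fst, ZeroMemClass.coe_zero, map_zero, add_zero, toLp_eq_add, map_add, WithLp.add_fst,
    hAL, hL, hZ, add_comm]
  rfl

end Cascade

/-! ### The characteristic function as a transfer operator -/

section Trajectory

variable {n : ℕ} {H : Type*} [NormedAddCommGroup H] [InnerProductSpace ℂ H] [CompleteSpace H]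

theorem continuous_fock_apply {E : Type*} [NormedAddCommGroup E] [InnerProductSpace ℂ E]
    (w : FreeMonoid (Fin n)) : Continuous fun f : FockTensor n E => f w :=
  (lp.evalCLM ℂ (fun _ : FreeMonoid (Fin n) => E) 2 w).continuous

/-- `Θ` is the transfer operator of the colligation `U`: the values of `Θ f` are the outputs of `U`
along the trajectory that starts at `0` and has the input `f`. -/
def IsTransfer {H E F : Type*} [NormedAddCommGroup H] [InnerProductSpace ℂ H]
    [NormedAddCommGroup E] [InnerProductSpace ℂ E] [NormedAddCommGroup F] [InnerProductSpace ℂ F]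
    (U : Colligation H E (PiLp 2 fun _ : Fin n => H) F)
    (Θ : FockTensor n E →L[ℂ] FockTensor n F) : Prop :=
  ∀ f, ∃ h : FreeMonoid (Fin n) → H, h 1 = 0 ∧
    (∀ w j, h (w * FreeMonoid.of j) = (U (WithLp.toLp 2 (h w, f w))).fst j) ∧
    ∀ w, Θ f w = (U (WithLp.toLp 2 (h w, f w))).snd

/-- For `r < 1` the states satisfy the recursion of the Julia colligation with an additional factor
`r`. Each step is continuous, so the states converge at every single word by induction on its
length. Only pointwise limits are needed: the limiting trajectory is not required to be
square-summable. -/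
theorem charFun_isTransfer (T : Fin n → H →L[ℂ] H) (hT : ‖rowOp T‖ ≤ 1) :
    IsTransfer (julia (rowOp T) hT) (charFun T) := by
  intro f
  have hev : ∀ᶠ r : ℝ in 𝓝[<] 1, 0 ≤ r ∧ r < 1 := by
    filter_upwards [Ioo_mem_nhdsLT (zero_lt_one' ℝ)] with r hr using ⟨hr.1.le, hr.2⟩
  have hone : Tendsto (fun r : ℝ => charState T r f 1) (𝓝[<] 1) (𝓝 0) := by
    refine tendsto_const_nhds.congr' ?_
    filter_upwards [hev] with r hr using (charState_one T hT hr.1 hr.2 f).symm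
  have hstep : ∀ w j x, Tendsto (fun r : ℝ => charState T r f w) (𝓝[<] 1) (𝓝 x) →
      Tendsto (fun r : ℝ => charState T r f (w * FreeMonoid.of j)) (𝓝[<] 1)
        (𝓝 ((julia (rowOp T) hT (WithLp.toLp 2 (x, f w))).fst j)) := by
    intro w j x hx
    have hr : Tendsto (fun r : ℝ => (r : ℂ)) (𝓝[<] 1) (𝓝 1) := by
      have := (Complex.continuous_ofReal.tendsto (1 : ℝ)).mono_left
        (nhdsWithin_le_nhds (s := Set.Iio 1))
      simpa using this
    have h1 : Continuous fun x : H => (ContinuousLinearMap.adjoint (rowOp T) x +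
        defectOp (rowOp T) (f w : PiLp 2 (fun _ : Fin n => H))) j := by fun_prop
    have h2 := hr.smul ((h1.tendsto x).comp hx)
    rw [one_smul] at h2
    refine h2.congr' ?_
    filter_upwards [hev] with r hr using (charState_mul T hT hr.1 hr.2 f w j).symm
  have hex : ∀ w, ∃ x, Tendsto (fun r : ℝ => charState T r f w) (𝓝[<] 1) (𝓝 x) := by
    intro w
    induction w using List.reverseRecOn with
    | nil => exact ⟨0, hone⟩
    | append_singleton l j ih => exact ⟨_, hstep l j _ ih.choose_spec⟩
  choose h hh using hex
  refine ⟨h, tendsto_nhds_unique (hh 1) hone,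
    fun w j => tendsto_nhds_unique (hh _) (hstep w j _ (hh w)), fun w => Subtype.ext ?_⟩
  have h1 := ((continuous_subtype_val.comp (continuous_fock_apply w)).tendsto _).comp
    (charFun_spec T hT f)
  refine tendsto_nhds_unique h1 ?_
  refine ((((defectOp (ContinuousLinearMap.adjoint (rowOp T))).continuous.tendsto _).comp (hh w)).sub_const
    (rowOp T (f w : PiLp 2 (fun _ : Fin n => H)))).congr fun r => ?_
  exact (charFunAt_apply T hT r f w).symm

end Trajectory

/-! ### Compression to `N ⊗ E` -/

section Compression

variable {n : ℕ} {E F G : Type*} [NormedAddCommGroup E] [InnerProductSpace ℂ E]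
  [NormedAddCommGroup F] [InnerProductSpace ℂ F] [NormedAddCommGroup G] [InnerProductSpace ℂ G]

theorem inner_elem_left (x : Fock n) (η : E) (f : FockTensor n E) :
    ⟪elem x η, f⟫_ℂ = ⟪x, idTensor (innerSL ℂ η) f⟫_ℂ := by
  simp only [lp.inner_eq_tsum, elem_apply, inner_smul_left, idTensor_apply, innerSL_apply_apply,
    RCLike.inner_apply]
  exact tsum_congr fun w => mul_comm _ _

/-- The complement of `N ⊗ E` is `Nᗮ ⊗ E`, expressed through the scalar slices `(I ⊗ ⟨η, ·⟩) f`.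
Invariance questions on `Γ ⊗ E` thereby reduce to `Γ`. -/
theorem mem_subTensor_orthogonal_iff (N : Submodule ℂ (Fock n)) (f : FockTensor n E) :
    f ∈ (subTensor E N)ᗮ ↔ ∀ η : E, idTensor (innerSL ℂ η) f ∈ Nᗮ := by
  rw [subTensor, Submodule.orthogonal_closure, Submodule.mem_orthogonal]
  constructor
  · intro h η
    rw [Submodule.mem_orthogonal]
    intro x hx
    rw [← inner_elem_left]
    exact h _ (Submodule.subset_span ⟨x, hx, η, rfl⟩)
  · intro h u hu
    induction hu using Submodule.span_induction with
    | mem u hu =>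
      obtain ⟨x, hx, η, rfl⟩ := hu
      rw [inner_elem_left]
      exact (Submodule.mem_orthogonal _ _).1 (h η) x hx
    | zero => exact inner_zero_left _
    | add u v _ _ hu hv => rw [inner_add_left, hu, hv, add_zero]
    | smul c u _ hu => rw [inner_smul_left, hu, mul_zero]

/-- The slice of `(I ⊗ A) f` at `η` is the slice of `f` at `A* η`. -/
theorem idTensor_mem_orthogonal [CompleteSpace E] [CompleteSpace F] (N : Submodule ℂ (Fock n))
    (A : E →L[ℂ] F) {f : FockTensor n E} (hf : f ∈ (subTensor E N)ᗮ) : idTensor A f ∈ (subTensor F N)ᗮ := by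
  rw [mem_subTensor_orthogonal_iff] at hf ⊢
  intro η
  convert hf (ContinuousLinearMap.adjoint A η) using 1
  ext w
  simp [ContinuousLinearMap.adjoint_inner_left]

/-- Slicing commutes with the right creation operators. -/
theorem rightCreation_mem_orthogonal {N : Submodule ℂ (Fock n)}
    (hN : ∀ j, ∀ x ∈ Nᗮ, rightCreation j x ∈ Nᗮ) (j : Fin n) {f : FockTensor n E}
    (hf : f ∈ (subTensor E N)ᗮ) : rightCreation j f ∈ (subTensor E N)ᗮ := by
  rw [mem_subTensor_orthogonal_iff] at hf ⊢
  intro η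
  convert hN j _ (hf η) using 1
  ext w
  obtain ⟨o, rfl⟩ := (wordEquiv n).surjective w
  rcases o with _ | ⟨v, i⟩
  · change innerSL ℂ η (rightCreation j f 1) = rightCreation j _ 1
    rw [rightCreation_apply_one, rightCreation_apply_one, map_zero]
  · change innerSL ℂ η (rightCreation j f (v * FreeMonoid.of i)) =
      rightCreation j _ (v * FreeMonoid.of i)
    by_cases hij : i = j
    · subst hij
      rw [rightCreation_apply_mul, rightCreation_apply_mul]
      rfl
    · rw [rightCreation_apply_mul_ne hij, rightCreation_apply_mul_ne hij, map_zero]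

/-- The inverse is the sum of the Neumann series, and every power of `X` preserves `M`. -/
theorem inverse_one_sub_mem {A : Type*} [NormedAddCommGroup A] [InnerProductSpace ℂ A]
    [CompleteSpace A] (X : A →L[ℂ] A) (hX : ‖X‖ < 1) (M : Submodule ℂ A)
    (hM : IsClosed (M : Set A)) (h : ∀ x ∈ M, X x ∈ M) {x : A} (hx : x ∈ M) :
    Ring.inverse (1 - X) x ∈ M := by
  have h1 := hasSum_geom_series_inverse X hX
  have h2 : HasSum (fun k => (X ^ k) x) (Ring.inverse (1 - X) x) :=
    h1.mapL (ContinuousLinearMap.apply ℂ A x)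
  have h3 : ∀ k, (X ^ k) x ∈ M := by
    intro k
    induction k with
    | zero => simpa using hx
    | succ k ih =>
      rw [pow_succ']
      exact h _ ih
  exact hM.mem_of_tendsto h2 (Eventually.of_forall fun s => sum_mem fun k _ => h3 k)

/-- `Θ` maps the orthogonal complement of `N ⊗ E` into that of `N ⊗ F`. -/
def PreservesOrthogonal (N : Submodule ℂ (Fock n)) (Θ : FockTensor n E →L[ℂ] FockTensor n F) :
    Prop :=
  ∀ f ∈ (subTensor E N)ᗮ, Θ f ∈ (subTensor F N)ᗮ

variable {H : Type*} [NormedAddCommGroup H] [InnerProductSpace ℂ H] [CompleteSpace H]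

/-- For `r < 1` the operator `Θ_T(r R̃)` is composed of right creations, operators `I ⊗ A` and a
resolvent given by a Neumann series, all of which preserve the complements. These are closed, so the
property survives the strong limit. -/
theorem charFun_preservesOrthogonal {N : Submodule ℂ (Fock n)}
    (hN : ∀ j, ∀ x ∈ Nᗮ, rightCreation j x ∈ Nᗮ) (T : Fin n → H →L[ℂ] H)
    (hT : IsRowContraction T) : PreservesOrthogonal N (charFun T) := by
  intro f hf
  refine (Submodule.isClosed_orthogonal _).mem_of_tendsto (charFun_spec T hT f) ?_
  filter_upwards [Ioo_mem_nhdsLT (zero_lt_one' ℝ)] with r hr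
  have hn : ‖(r : ℂ) • creationAdj T‖ < 1 := by
    rw [norm_smul, Complex.norm_real, Real.norm_of_nonneg hr.1.le]
    nlinarith [norm_creationAdj_le T hT, hr.1, hr.2, norm_nonneg (creationAdj T)]
  have h1 : creationDefect T f ∈ (subTensor H N)ᗮ := by
    rw [creationDefect, sum_apply]
    exact sum_mem fun j _ => rightCreation_mem_orthogonal hN j (idTensor_mem_orthogonal N _ hf)
  have h2 : ∀ g ∈ (subTensor H N)ᗮ, ((r : ℂ) • creationAdj T) g ∈ (subTensor H N)ᗮ := by
    intro g hg
    refine Submodule.smul_mem _ _ ?_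
    change creationAdj T g ∈ _
    rw [creationAdj, sum_apply]
    exact sum_mem fun j _ => rightCreation_mem_orthogonal hN j (idTensor_mem_orthogonal N _ hg)
  exact add_mem (neg_mem (idTensor_mem_orthogonal N _ hf)) (idTensor_mem_orthogonal N _
    (inverse_one_sub_mem _ hn _ (Submodule.isClosed_orthogonal _) h2
      (Submodule.smul_mem _ (r : ℂ) h1)))

/-- The compression of `Θ` to an operator from `N ⊗ E` to `N ⊗ F`. -/
def compress [CompleteSpace F] (N : Submodule ℂ (Fock n)) (Θ : FockTensor n E →L[ℂ] FockTensor n F) :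
    subTensor E N →L[ℂ] subTensor F N :=
  (subTensor F N).orthogonalProjectionOnto ∘L Θ ∘L (subTensor E N).subtypeL

/-- With `P` the projection onto `N ⊗ F`, the error term is the compression of `Θ (I - P) Φ`. It
vanishes because `Θ` keeps the range of `I - P` inside the complement; nothing is required of `Φ`.
-/
theorem compress_comp [CompleteSpace F] [CompleteSpace G] {N : Submodule ℂ (Fock n)}
    {Θ : FockTensor n F →L[ℂ] FockTensor n G}
    (hΘ : PreservesOrthogonal N Θ) (Φ : FockTensor n E →L[ℂ] FockTensor n F) :
    compress N (Θ ∘L Φ) = compress N Θ ∘L compress N Φ := by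
  ext1 f
  have h : Φ f - (subTensor F N).orthogonalProjectionOnto (Φ f) ∈ (subTensor F N)ᗮ :=
    Submodule.sub_starProjection_mem_orthogonal _
  have h1 := hΘ _ h
  rw [map_sub] at h1
  have h2 := Submodule.orthogonalProjectionOnto_apply_of_mem_orthogonal h1
  rw [map_sub, sub_eq_zero] at h2
  exact h2

theorem compress_add [CompleteSpace F] (N : Submodule ℂ (Fock n))
    (Θ Φ : FockTensor n E →L[ℂ] FockTensor n F) :
    compress N (Θ + Φ) = compress N Θ + compress N Φ := by
  ext1 f
  exact map_add (subTensor F N).orthogonalProjectionOnto _ _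

theorem compress_idTensor [CompleteSpace F] (N : Submodule ℂ (Fock n)) (A : E →L[ℂ] F) :
    compress N (idTensor A) = idTensorOn N A := by
  ext1 f
  exact Submodule.orthogonalProjectionOnto_mem_subspace_eq_self (⟨_, idTensor_mem N A f f.2⟩ : subTensor F N)

/-- The block diagonal operator `diag(Θ, I_{Γ ⊗ G})`. -/
def diagFull (Θ : FockTensor n E →L[ℂ] FockTensor n F) (G : Type*) [NormedAddCommGroup G]
    [InnerProductSpace ℂ G] :
    FockTensor n (WithLp 2 (E × G)) →L[ℂ] FockTensor n (WithLp 2 (F × G)) :=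
  idTensor (inlL F G) ∘L Θ ∘L idTensor (WithLp.fstL 2 ℂ E G) +
    idTensor (inrL F G) ∘L idTensor (WithLp.sndL 2 ℂ E G)

theorem diagFull_apply (Θ : FockTensor n E →L[ℂ] FockTensor n F)
    (f : FockTensor n (WithLp 2 (E × G))) (w : FreeMonoid (Fin n)) :
    diagFull Θ G f w =
      WithLp.toLp 2 (Θ (idTensor (WithLp.fstL 2 ℂ E G) f) w, (f w).snd) := by
  rw [toLp_eq_add]
  rfl

theorem idTensor_preservesOrthogonal [CompleteSpace E] [CompleteSpace F]
    (N : Submodule ℂ (Fock n)) (A : E →L[ℂ] F) :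
    PreservesOrthogonal N (idTensor A) := fun _ hf => idTensor_mem_orthogonal N A hf

theorem PreservesOrthogonal.comp {N : Submodule ℂ (Fock n)}
    {Θ : FockTensor n F →L[ℂ] FockTensor n G} {Φ : FockTensor n E →L[ℂ] FockTensor n F}
    (hΘ : PreservesOrthogonal N Θ) (hΦ : PreservesOrthogonal N Φ) :
    PreservesOrthogonal N (Θ ∘L Φ) := fun f hf => hΘ _ (hΦ f hf)

theorem PreservesOrthogonal.diagFull [CompleteSpace E] [CompleteSpace F] [CompleteSpace G]
    {N : Submodule ℂ (Fock n)}
    {Θ : FockTensor n E →L[ℂ] FockTensor n F} (hΘ : PreservesOrthogonal N Θ) :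
    PreservesOrthogonal N (diagFull Θ G) := fun _ hf =>
  add_mem (idTensor_mem_orthogonal N _ (hΘ _ (idTensor_mem_orthogonal N _ hf)))
    (idTensor_mem_orthogonal N _ (idTensor_mem_orthogonal N _ hf))

theorem diagId_compress [CompleteSpace E] [CompleteSpace F] [CompleteSpace G]
    {N : Submodule ℂ (Fock n)} {Θ : FockTensor n E →L[ℂ] FockTensor n F}
    (hΘ : PreservesOrthogonal N Θ) : diagId (compress N Θ) G = compress N (diagFull Θ G) := by
  rw [diagFull, compress_add, compress_comp (idTensor_preservesOrthogonal N _),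
    compress_comp hΘ, compress_comp (idTensor_preservesOrthogonal N _)]
  simp only [compress_idTensor]
  rfl

end Compression

/-! ### Right creations leave `ℳ_J` invariant -/

section Ideal

variable {n : ℕ}

theorem push_push_apply {E : Type*} [NormedAddCommGroup E] [InnerProductSpace ℂ E]
    (g g' : FreeMonoid (Fin n) → FreeMonoid (Fin n)) (hg : Function.Injective g)
    (hg' : Function.Injective g') (f : FockTensor n E) (w : FreeMonoid (Fin n)) :
    push g hg (push g' hg' f) w = Function.extend (fun v => g (g' v)) (fun v => f v) 0 w := by
  change Function.extend g (fun v => Function.extend g' (fun v => f v) 0 v) 0 w = _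
  by_cases h : ∃ v, g v = w
  · obtain ⟨v, rfl⟩ := h
    rw [hg.extend_apply]
    by_cases h' : ∃ u, g' u = v
    · obtain ⟨u, rfl⟩ := h'
      rw [hg'.extend_apply]
      exact ((hg.comp hg').extend_apply _ _ u).symm
    · rw [Function.extend_apply' _ _ _ h', Function.extend_apply']
      · rfl
      · rintro ⟨u, hu⟩
        exact h' ⟨u, hg hu⟩
  · rw [Function.extend_apply' _ _ _ h, Function.extend_apply']
    rintro ⟨u, hu⟩
    exact h ⟨_, hu⟩

theorem leftCreation_rightCreation (i j : Fin n) (x : Fock n) :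
    leftCreation i (rightCreation j x) = rightCreation j (leftCreation i x) := by
  ext w
  rw [leftCreation, rightCreation, push_push_apply, push_push_apply]
  simp only [mul_assoc]

theorem commute_evalPoly_rightCreation (p : FreeAlgebra ℂ (Fin n)) (j : Fin n) :
    Commute (evalPoly (leftCreation (E := ℂ)) p) (rightCreation j) := by
  induction p using FreeAlgebra.induction with
  | grade0 r =>
    rw [evalPoly, AlgHom.commutes]
    exact Algebra.commutes r _
  | grade1 i =>
    rw [evalPoly, FreeAlgebra.lift_ι_apply]
    exact ContinuousLinearMap.ext fun x => leftCreation_rightCreation i j x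
  | mul a b ha hb =>
    rw [evalPoly, map_mul]
    exact ha.mul_left hb
  | add a b ha hb =>
    rw [evalPoly, map_add]
    exact ha.add_left hb

/-- Left and right creations commute because concatenation of words is associative. Commuting with
`R_j` is a condition closed in the weak operator topology, so it passes from polynomials to `F_n^∞`.
-/
theorem toeplitzAlg_commute {A : Fock n →L[ℂ] Fock n} (hA : A ∈ toeplitzAlg n) (j : Fin n)
    (x : Fock n) : A (rightCreation j x) = rightCreation j (A x) := by
  let s : Set (Fock n →WOT[ℂ] Fock n) := {B | ∀ x y : Fock n,
    innerSL ℂ y (B (rightCreation j x)) = ((innerSL ℂ y) ∘L rightCreation j) (B x)}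
  have hs : IsClosed s := by
    simp only [s, Set.ofPred_forall]
    exact isClosed_iInter fun x => isClosed_iInter fun y => isClosed_eq
      (ContinuousLinearMapWOT.continuous_dual_apply _ _)
      (ContinuousLinearMapWOT.continuous_dual_apply _ _)
  have h : ContinuousLinearMapWOT.ofCLM A ∈ s := by
    refine closure_minimal ?_ hs hA
    rintro B ⟨p, hp⟩ x y
    have h1 := congrArg (fun M : Fock n →L[ℂ] Fock n => M x) (commute_evalPoly_rightCreation p j).eq
    rw [← hp] at h1
    exact congrArg (innerSL ℂ y) h1
  exact ext_inner_left ℂ fun y => h x y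

/-- The reason is `R_j (φ ψ) = φ (R_j ψ)` for `φ ∈ J`. -/
theorem rightCreation_mem_subspaceM (P : Set (FreeAlgebra ℂ (Fin n))) (j : Fin n) {x : Fock n}
    (hx : x ∈ subspaceM P) : rightCreation j x ∈ subspaceM P := by
  have h : subspaceM P ≤ (subspaceM P).comap (rightCreation j).toLinearMap := by
    refine Submodule.topologicalClosure_minimal _ (Submodule.span_le.2 ?_)
      ((Submodule.isClosed_topologicalClosure _).preimage (rightCreation j).continuous)
    rintro _ ⟨φ, hφ, ψ, rfl⟩
    refine Submodule.le_topologicalClosure _ (Submodule.subset_span ?_)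
    -- Over an empty family the infimum defining `wotIdeal` would consist of all operators. It would
    -- then contain `R_j φ` as well, so this case need not be excluded.
    by_cases hK : ∃ K, IsWOTIdeal K ∧ ∀ p ∈ P, evalPoly leftCreation p ∈ K
    · obtain ⟨K, hK⟩ := hK
      have hφK : φ ∈ K := (Submodule.mem_sInf.1 hφ) K hK
      exact ⟨φ, hφ, rightCreation j ψ, (toeplitzAlg_commute (hK.1.subset φ hφK) j ψ).symm⟩
    · exact ⟨rightCreation j ∘L φ, Submodule.mem_sInf.2 fun K hK' => (hK ⟨K, hK'⟩).elim, ψ, rfl⟩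
  exact h hx

theorem rightCreation_mem_subspaceN_orthogonal (P : Set (FreeAlgebra ℂ (Fin n))) (j : Fin n)
    (x : Fock n) (hx : x ∈ (subspaceN P)ᗮ) : rightCreation j x ∈ (subspaceN P)ᗮ := by
  have h : (subspaceN P)ᗮ = subspaceM P := by
    rw [subspaceN, Submodule.orthogonal_orthogonal_eq_closure]
    exact (Submodule.isClosed_topologicalClosure _).submodule_topologicalClosure_eq
  rw [h] at hx ⊢
  exact rightCreation_mem_subspaceM P j hx

end Ideal

/-! ### Upper triangular tuples and their diagonal entries -/

section Triangular

variable {n : ℕ} {H₁ H₀ H₂ : Type*} [NormedAddCommGroup H₁] [InnerProductSpace ℂ H₁]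
  [NormedAddCommGroup H₀] [InnerProductSpace ℂ H₀] [NormedAddCommGroup H₂] [InnerProductSpace ℂ H₂]

theorem evalPoly_intertwine {A B : Type*} [NormedAddCommGroup A] [InnerProductSpace ℂ A]
    [NormedAddCommGroup B] [InnerProductSpace ℂ B] (V : A →L[ℂ] B) (S : Fin n → A →L[ℂ] A)
    (T : Fin n → B →L[ℂ] B) (h : ∀ i x, V (S i x) = T i (V x)) (p : FreeAlgebra ℂ (Fin n)) (x : A) :
    V (evalPoly S p x) = evalPoly T p (V x) := by
  induction p using FreeAlgebra.induction generalizing x with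
  | grade0 r =>
    rw [evalPoly, evalPoly, AlgHom.commutes, AlgHom.commutes]
    exact V.map_smul r x
  | grade1 i =>
    rw [evalPoly, evalPoly, FreeAlgebra.lift_ι_apply, FreeAlgebra.lift_ι_apply]
    exact h i x
  | mul a b ha hb =>
    rw [evalPoly, evalPoly, map_mul, map_mul]
    exact (ha _).trans (congrArg _ (hb x))
  | add a b ha hb =>
    rw [evalPoly, evalPoly, map_add, map_add]
    exact (V.map_add _ _).trans (congrArg₂ (· + ·) (ha x) (hb x))

theorem IsUpperTriangular.evalPoly_eq_zero {T : Fin n → Sum3 H₁ H₀ H₂ →L[ℂ] Sum3 H₁ H₀ H₂}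
    {S : Fin n → H₁ →L[ℂ] H₁} {N : Fin n → H₀ →L[ℂ] H₀} {C : Fin n → H₂ →L[ℂ] H₂}
    {X : Fin n → H₀ →L[ℂ] H₁} {Y : Fin n → H₂ →L[ℂ] H₁} {Z : Fin n → H₂ →L[ℂ] H₀}
    (hT : ∀ i, IsUpperTriangular (T i) (S i) (X i) (Y i) (N i) (Z i) (C i))
    {p : FreeAlgebra ℂ (Fin n)} (hp : evalPoly T p = 0) :
    evalPoly S p = 0 ∧ evalPoly N p = 0 ∧ evalPoly C p = 0 := by
  -- `T'` is the lower right corner, intertwined with `T` by the projection along the invariant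
  -- subspace `H₁`. In turn `N` is a restriction of `T'`, and `C` is obtained from `T'` by a
  -- projection, so polynomial relations pass from `T` to each diagonal entry.
  let T' : Fin n → WithLp 2 (H₀ × H₂) →L[ℂ] WithLp 2 (H₀ × H₂) := fun i =>
    WithLp.sndL 2 ℂ H₁ _ ∘L T i ∘L inrL H₁ _
  have hT' : ∀ i x y, T' i (WithLp.toLp 2 (x, y)) = WithLp.toLp 2 (N i x + Z i y, C i y) :=
    fun i x y => congrArg WithLp.snd (hT i 0 x y)
  have e1 : ∀ x, evalPoly T' p x = 0 := fun x => by
    have h := evalPoly_intertwine (WithLp.sndL 2 ℂ H₁ _) T T' (fun i y => by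
      obtain ⟨u, v, w⟩ := y
      exact (congrArg WithLp.snd (hT i u v w)).trans (hT' i v w).symm) p (inrL H₁ _ x)
    rw [hp] at h
    exact h.symm
  refine ⟨ContinuousLinearMap.ext fun x => ?_, ContinuousLinearMap.ext fun x => ?_,
    ContinuousLinearMap.ext fun x => ?_⟩
  · have h := evalPoly_intertwine (inlL H₁ _) S T (fun i y => by
      refine Eq.trans ?_ (hT i y 0 0).symm
      simp only [map_zero, add_zero]
      rfl) p x
    rw [hp] at h
    exact congrArg WithLp.fst h
  · have h := evalPoly_intertwine (inlL H₀ H₂) N T' (fun i y => by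
      refine Eq.trans ?_ (hT' i y 0).symm
      simp only [map_zero, add_zero]
      rfl) p x
    rw [e1] at h
    exact congrArg WithLp.fst h
  · have h := evalPoly_intertwine (WithLp.sndL 2 ℂ H₀ H₂) T' C (fun i y => by
      obtain ⟨u, v⟩ := y
      exact congrArg WithLp.snd (hT' i u v)) p (inrL H₀ H₂ x)
    rw [e1] at h
    exact h.symm

variable (n H₁ H₀ H₂) in
/-- The identification of `(H₁ ⊕ H₀ ⊕ H₂)^n` with `H₁^n ⊕ H₀^n ⊕ H₂^n`. -/
def splitRow : PiLp 2 (fun _ : Fin n => Sum3 H₁ H₀ H₂) ≃ₗᵢ[ℂ]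
    Sum3 (PiLp 2 fun _ : Fin n => H₁) (PiLp 2 fun _ : Fin n => H₀) (PiLp 2 fun _ : Fin n => H₂) where
  toFun x := WithLp.toLp 2 (WithLp.toLp 2 fun j => (x j).fst,
    WithLp.toLp 2 (WithLp.toLp 2 fun j => (x j).snd.fst, WithLp.toLp 2 fun j => (x j).snd.snd))
  invFun y := WithLp.toLp 2 fun j =>
    WithLp.toLp 2 (y.fst j, WithLp.toLp 2 (y.snd.fst j, y.snd.snd j))
  map_add' _ _ := rfl
  map_smul' _ _ := rfl
  left_inv _ := rfl
  right_inv _ := rfl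
  norm_map' x := by
    refine (sq_eq_sq₀ (norm_nonneg _) (norm_nonneg _)).1 ?_
    rw [PiLp.norm_sq_eq_of_L2 _ x]
    change ‖WithLp.toLp 2 (WithLp.toLp 2 fun j => (x j).fst, WithLp.toLp 2
      (WithLp.toLp 2 fun j => (x j).snd.fst, WithLp.toLp 2 fun j => (x j).snd.snd))‖ ^ 2 = _
    simp [WithLp.prod_norm_sq_eq_of_L2, PiLp.norm_sq_eq_of_L2, Finset.sum_add_distrib]

variable {T : Fin n → Sum3 H₁ H₀ H₂ →L[ℂ] Sum3 H₁ H₀ H₂}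
    {S : Fin n → H₁ →L[ℂ] H₁} {N : Fin n → H₀ →L[ℂ] H₀} {C : Fin n → H₂ →L[ℂ] H₂}
    {X : Fin n → H₀ →L[ℂ] H₁} {Y : Fin n → H₂ →L[ℂ] H₁} {Z : Fin n → H₂ →L[ℂ] H₀}

variable [CompleteSpace H₁] [CompleteSpace H₀] [CompleteSpace H₂]

/-- The adjoint of the row operator of `T`, as an operator to `H₁^n ⊕ H₀^n ⊕ H₂^n`. -/
def splitAdjoint (T : Fin n → Sum3 H₁ H₀ H₂ →L[ℂ] Sum3 H₁ H₀ H₂) : Sum3 H₁ H₀ H₂ →L[ℂ]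
    Sum3 (PiLp 2 fun _ : Fin n => H₁) (PiLp 2 fun _ : Fin n => H₀) (PiLp 2 fun _ : Fin n => H₂) :=
  (splitRow n H₁ H₀ H₂ : _ →L[ℂ] _) ∘L ContinuousLinearMap.adjoint (rowOp T)

theorem norm_splitAdjoint_le (hT : IsRowContraction T) : ‖splitAdjoint T‖ ≤ 1 := by
  refine ContinuousLinearMap.opNorm_le_bound _ zero_le_one fun x => ?_
  refine ((splitRow n H₁ H₀ H₂).norm_map _).trans_le ?_
  exact (ContinuousLinearMap.adjoint (rowOp T)).le_of_opNorm_le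
    ((ContinuousLinearMap.adjoint.norm_map (rowOp T)).trans_le hT) x

/-- The adjoint of an upper triangular matrix is lower triangular with the adjoint diagonal. This
lemma and its two companions extract the entries in the form that the cascade construction asks for.
-/
theorem splitAdjoint_fst (hT : ∀ i, IsUpperTriangular (T i) (S i) (X i) (Y i) (N i) (Z i) (C i))
    (h₁ : H₁) (h : WithLp 2 (H₀ × H₂)) :
    (splitAdjoint T (WithLp.toLp 2 (h₁, h))).fst = ContinuousLinearMap.adjoint (rowOp S) h₁ := by
  ext j
  change (ContinuousLinearMap.adjoint (rowOp T) (WithLp.toLp 2 (h₁, h)) j).fst = _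
  rw [rowOp_adjoint_apply, rowOp_adjoint_apply]
  refine ext_inner_left ℂ fun y => ?_
  have e := ContinuousLinearMap.adjoint_inner_right (T j)
    (WithLp.toLp 2 (y, WithLp.toLp 2 (0, 0))) (WithLp.toLp 2 (h₁, h))
  rw [hT, WithLp.prod_inner_apply, WithLp.prod_inner_apply] at e
  simpa [ContinuousLinearMap.adjoint_inner_right] using e

theorem splitAdjoint_snd_fst
    (hT : ∀ i, IsUpperTriangular (T i) (S i) (X i) (Y i) (N i) (Z i) (C i)) (h₀ : H₀) (h₂ : H₂) :
    (splitAdjoint T (WithLp.toLp 2 (0, WithLp.toLp 2 (h₀, h₂)))).snd.fst =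
      ContinuousLinearMap.adjoint (rowOp N) h₀ := by
  ext j
  change (ContinuousLinearMap.adjoint (rowOp T)
    (WithLp.toLp 2 (0, WithLp.toLp 2 (h₀, h₂))) j).snd.fst = _
  rw [rowOp_adjoint_apply, rowOp_adjoint_apply]
  refine ext_inner_left ℂ fun y => ?_
  have e := ContinuousLinearMap.adjoint_inner_right (T j)
    (WithLp.toLp 2 (0, WithLp.toLp 2 (y, 0))) (WithLp.toLp 2 (0, WithLp.toLp 2 (h₀, h₂)))
  rw [hT, WithLp.prod_inner_apply, WithLp.prod_inner_apply, WithLp.prod_inner_apply,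
    WithLp.prod_inner_apply] at e
  simpa [ContinuousLinearMap.adjoint_inner_right] using e

theorem splitAdjoint_snd_snd
    (hT : ∀ i, IsUpperTriangular (T i) (S i) (X i) (Y i) (N i) (Z i) (C i)) (h₂ : H₂) :
    (splitAdjoint T (WithLp.toLp 2 (0, WithLp.toLp 2 (0, h₂)))).snd.snd =
      ContinuousLinearMap.adjoint (rowOp C) h₂ := by
  ext j
  change (ContinuousLinearMap.adjoint (rowOp T)
    (WithLp.toLp 2 (0, WithLp.toLp 2 (0, h₂))) j).snd.snd = _
  rw [rowOp_adjoint_apply, rowOp_adjoint_apply]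
  refine ext_inner_left ℂ fun y => ?_
  have e := ContinuousLinearMap.adjoint_inner_right (T j)
    (WithLp.toLp 2 (0, WithLp.toLp 2 (0, y))) (WithLp.toLp 2 (0, WithLp.toLp 2 (0, h₂)))
  rw [hT, WithLp.prod_inner_apply, WithLp.prod_inner_apply, WithLp.prod_inner_apply,
    WithLp.prod_inner_apply] at e
  simpa [ContinuousLinearMap.adjoint_inner_right] using e

theorem isRowContraction_of_adjoint {H : Type*} [NormedAddCommGroup H] [InnerProductSpace ℂ H]
    [CompleteSpace H] {R : Fin n → H →L[ℂ] H}
    (h : ∀ x, ‖ContinuousLinearMap.adjoint (rowOp R) x‖ ≤ ‖x‖) : IsRowContraction R := by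
  have : ‖ContinuousLinearMap.adjoint (rowOp R)‖ ≤ 1 :=
    ContinuousLinearMap.opNorm_le_bound _ zero_le_one fun x => by rw [one_mul]; exact h x
  exact (ContinuousLinearMap.adjoint.norm_map (rowOp R)).symm.trans_le this

/-- The adjoint of each diagonal row is a corner of the contraction `splitAdjoint T`. -/
theorem IsUpperTriangular.isRowContraction
    (hT : ∀ i, IsUpperTriangular (T i) (S i) (X i) (Y i) (N i) (Z i) (C i))
    (hc : IsRowContraction T) :
    IsRowContraction S ∧ IsRowContraction N ∧ IsRowContraction C := by
  have hM : ∀ x, ‖splitAdjoint T x‖ ≤ ‖x‖ := fun x => by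
    simpa using (splitAdjoint T).le_of_opNorm_le (norm_splitAdjoint_le hc) x
  refine ⟨isRowContraction_of_adjoint fun x => ?_, isRowContraction_of_adjoint fun x => ?_,
    isRowContraction_of_adjoint fun x => ?_⟩
  · rw [← splitAdjoint_fst hT x 0]
    refine (WithLp.norm_fst_le ..).trans ((hM _).trans ?_)
    simp
  · rw [← splitAdjoint_snd_fst hT x 0]
    refine (WithLp.norm_fst_le ..).trans ((WithLp.norm_snd_le ..).trans ((hM _).trans ?_))
    simp
  · rw [← splitAdjoint_snd_snd hT x]
    refine (WithLp.norm_snd_le ..).trans ((WithLp.norm_snd_le ..).trans ((hM _).trans ?_))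
    simp

end Triangular

/-! ### Transfer operators of cascades -/

section Transfer

theorem eq_toLp_of_eq_snd {A B : Type*} (x : WithLp 2 (A × B)) {b : B} (h : b = x.snd) :
    x = WithLp.toLp 2 (x.fst, b) := by
  subst h
  rfl

variable {n : ℕ} {H₁ H₀ H₂ D D₁ D₀ D₂ F F₁ F₀ F₂ E₂ G₁ G₂ G₃ : Type*}
  [NormedAddCommGroup H₁] [InnerProductSpace ℂ H₁] [NormedAddCommGroup H₀] [InnerProductSpace ℂ H₀]
  [NormedAddCommGroup H₂] [InnerProductSpace ℂ H₂] [NormedAddCommGroup D] [InnerProductSpace ℂ D]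
  [NormedAddCommGroup D₁] [InnerProductSpace ℂ D₁] [NormedAddCommGroup D₀] [InnerProductSpace ℂ D₀]
  [NormedAddCommGroup D₂] [InnerProductSpace ℂ D₂] [NormedAddCommGroup F] [InnerProductSpace ℂ F]
  [NormedAddCommGroup F₁] [InnerProductSpace ℂ F₁] [NormedAddCommGroup F₀] [InnerProductSpace ℂ F₀]
  [NormedAddCommGroup F₂] [InnerProductSpace ℂ F₂] [NormedAddCommGroup E₂] [InnerProductSpace ℂ E₂]
  [NormedAddCommGroup G₁] [InnerProductSpace ℂ G₁] [NormedAddCommGroup G₂] [InnerProductSpace ℂ G₂]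
  [NormedAddCommGroup G₃] [InnerProductSpace ℂ G₃]

/-- If a colligation is unitarily equivalent to a cascade, then its transfer operator is the
corresponding product of transfer operators. -/
theorem IsTransfer.eq_of_cascade
    {V : Colligation (Sum3 H₁ H₀ H₂) D (PiLp 2 fun _ : Fin n => Sum3 H₁ H₀ H₂) F}
    {U₁ : Colligation H₁ D₁ (PiLp 2 fun _ : Fin n => H₁) F₁}
    {U₀ : Colligation H₀ D₀ (PiLp 2 fun _ : Fin n => H₀) F₀}
    {U₂ : Colligation H₂ D₂ (PiLp 2 fun _ : Fin n => H₂) F₂}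
    {Θ : FockTensor n D →L[ℂ] FockTensor n F} {Θ₁ : FockTensor n D₁ →L[ℂ] FockTensor n F₁}
    {Θ₀ : FockTensor n D₀ →L[ℂ] FockTensor n F₀} {Θ₂ : FockTensor n D₂ →L[ℂ] FockTensor n F₂}
    (hV : IsTransfer V Θ) (h₁ : IsTransfer U₁ Θ₁) (h₀ : IsTransfer U₀ Θ₀) (h₂ : IsTransfer U₂ Θ₂)
    (σ₁ : Colligation F₀ G₁ D₂ G₂) (σ₂ : Colligation F₁ E₂ (WithLp 2 (D₀ × G₁)) G₃)
    (W : D ≃ₗᵢ[ℂ] WithLp 2 (D₁ × E₂)) (Ws : F ≃ₗᵢ[ℂ] WithLp 2 (WithLp 2 (F₂ × G₂) × G₃))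
    (τ₁ : WithLp 2 (F₀ × WithLp 2 (G₁ × G₃)) ≃ₗᵢ[ℂ] WithLp 2 (D₂ × WithLp 2 (G₂ × G₃)))
    (hτ₁ : ∀ x g g', τ₁ (WithLp.toLp 2 (x, WithLp.toLp 2 (g, g'))) =
      WithLp.toLp 2 ((σ₁ (WithLp.toLp 2 (x, g))).fst,
        WithLp.toLp 2 ((σ₁ (WithLp.toLp 2 (x, g))).snd, g')))
    (τ₂ : WithLp 2 (F₁ × E₂) ≃ₗᵢ[ℂ] WithLp 2 (D₀ × WithLp 2 (G₁ × G₃)))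
    (hτ₂ : ∀ x, τ₂ x = WithLp.toLp 2 ((σ₂ x).fst.fst, WithLp.toLp 2 ((σ₂ x).fst.snd, (σ₂ x).snd)))
    (hW : ∀ x e, cascade U₁ (cascade U₀ U₂ σ₁) σ₂ (WithLp.toLp 2 (x, W e)) =
      WithLp.toLp 2 (splitRow n H₁ H₀ H₂ (V (WithLp.toLp 2 (x, e))).fst,
        Ws (V (WithLp.toLp 2 (x, e))).snd)) :
    idTensor ((Ws.trans (LinearIsometryEquiv.withLpProdAssoc 2 ℂ F₂ G₂ G₃) :
        F ≃ₗᵢ[ℂ] _) : F →L[ℂ] WithLp 2 (F₂ × WithLp 2 (G₂ × G₃))) ∘L Θ =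
    (diagFull Θ₂ (WithLp 2 (G₂ × G₃)) ∘L idTensor (τ₁ : _ →L[ℂ] _) ∘L
      diagFull Θ₀ (WithLp 2 (G₁ × G₃)) ∘L idTensor (τ₂ : _ →L[ℂ] _) ∘L
      diagFull Θ₁ E₂) ∘L idTensor (W : _ →L[ℂ] _) := by
  ext1 f
  set g := idTensor (W : D →L[ℂ] WithLp 2 (D₁ × E₂)) f
  -- `z₂` and `z₁` are the signals entering the second and third stages, together with the side
  -- channels that bypass these stages.
  set z₂ := idTensor (τ₂ : _ →L[ℂ] WithLp 2 (D₀ × WithLp 2 (G₁ × G₃)))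
    (diagFull Θ₁ E₂ g)
  set z₁ := idTensor (τ₁ : _ →L[ℂ] WithLp 2 (D₂ × WithLp 2 (G₂ × G₃)))
    (diagFull Θ₀ (WithLp 2 (G₁ × G₃)) z₂)
  obtain ⟨k, k0, k1, k2⟩ := hV f
  obtain ⟨a, a0, a1, a2⟩ := h₁ (idTensor (WithLp.fstL 2 ℂ _ _) g)
  obtain ⟨b, b0, b1, b2⟩ := h₀ (idTensor (WithLp.fstL 2 ℂ _ _) z₂)
  obtain ⟨c, c0, c1, c2⟩ := h₂ (idTensor (WithLp.fstL 2 ℂ _ _) z₁)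
  -- At every word, one run of the cascade on the three separate states performs one step of each
  -- separate trajectory.
  have key : ∀ w, cascade U₁
      (cascade U₀ U₂ σ₁) σ₂
      (WithLp.toLp 2 (WithLp.toLp 2 (a w, WithLp.toLp 2 (b w, c w)), W (f w))) =
      WithLp.toLp 2 (WithLp.toLp 2
        ((U₁ (WithLp.toLp 2 (a w, (g w).fst))).fst, WithLp.toLp 2
          ((U₀ (WithLp.toLp 2 (b w, (z₂ w).fst))).fst,
            (U₂ (WithLp.toLp 2 (c w, (z₁ w).fst))).fst)),
        WithLp.toLp 2 (WithLp.toLp 2 (Θ₂ (idTensor (WithLp.fstL 2 ℂ _ _) z₁) w,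
          (z₁ w).snd.fst), (z₁ w).snd.snd)) := by
    intro w
    have e2 : z₂ w = _ := (congrArg τ₂ (diagFull_apply Θ₁ g w)).trans (hτ₂ _)
    have e1 : z₁ w = _ := (congrArg τ₁ (diagFull_apply Θ₀ z₂ w)).trans
      (hτ₁ _ (z₂ w).snd.fst (z₂ w).snd.snd)
    have e3 : (z₁ w).snd.snd = (z₂ w).snd.snd :=
      congrArg (fun x => x.snd.snd) e1
    rw [e3]
    refine cascade_apply _ _ _ (f₁ := Θ₁ (idTensor (WithLp.fstL 2 ℂ _ _) g) w)
      (e₂ := WithLp.toLp 2 ((z₂ w).fst, (z₂ w).snd.fst)) ?_ ?_ ?_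
    · exact eq_toLp_of_eq_snd _ (a2 w)
    · change σ₂ (WithLp.toLp 2 (_, (g w).snd)) = _
      rw [e2]
      rfl
    · refine cascade_apply _ _ _ (f₁ := Θ₀ (idTensor (WithLp.fstL 2 ℂ _ _) z₂) w)
        (e₂ := (z₁ w).fst) ?_ ?_ ?_
      · exact eq_toLp_of_eq_snd _ (b2 w)
      · rw [e1]
        rfl
      · exact eq_toLp_of_eq_snd _ (c2 w)
  -- The trajectory of `V` is the triple of separate trajectories: both start at `0`, and by `hW`
  -- and `key` they obey the same recursion when a letter is appended on the right.
  have hk : ∀ l : List (Fin n), k (FreeMonoid.ofList l) =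
      WithLp.toLp 2 (a (FreeMonoid.ofList l),
        WithLp.toLp 2 (b (FreeMonoid.ofList l), c (FreeMonoid.ofList l))) := by
    intro l
    induction l using List.reverseRecOn with
    | nil =>
      refine k0.trans ?_
      change 0 = WithLp.toLp 2 (a 1, WithLp.toLp 2 (b 1, c 1))
      rw [a0, b0, c0]
      rfl
    | append_singleton l j ih =>
      have h1 := hW (k (FreeMonoid.ofList l)) (f (FreeMonoid.ofList l))
      rw [ih, key, ← ih] at h1
      have h2 := congrArg (fun x => (splitRow n H₁ H₀ H₂).symm x.fst j) h1
      have h3 := k1 (FreeMonoid.ofList l) j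
      have h4 := a1 (FreeMonoid.ofList l) j
      have h5 := b1 (FreeMonoid.ofList l) j
      have h6 := c1 (FreeMonoid.ofList l) j
      change k (FreeMonoid.ofList l * FreeMonoid.of j) = WithLp.toLp 2
        (a (FreeMonoid.ofList l * FreeMonoid.of j), WithLp.toLp 2
          (b (FreeMonoid.ofList l * FreeMonoid.of j), c (FreeMonoid.ofList l * FreeMonoid.of j)))
      refine h3.trans (Eq.trans ?_ (h2.symm.trans ?_))
      · exact (congrArg (fun x => x j) ((splitRow n H₁ H₀ H₂).symm_apply_apply _)).symm
      · exact (congrArg₂ (fun x y => WithLp.toLp 2 (x, y)) h4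
          (congrArg₂ (fun x y => WithLp.toLp 2 (x, y)) h5 h6)).symm
  ext1
  funext w
  have h1 := hW (k w) (f w)
  have hkw : k w = WithLp.toLp 2 (a w, WithLp.toLp 2 (b w, c w)) := hk (FreeMonoid.toList w)
  rw [hkw, key, ← hkw, ← k2] at h1
  refine (congrArg (fun x => LinearIsometryEquiv.withLpProdAssoc 2 ℂ _ G₂ G₃ x.snd) h1.symm).trans ?_
  exact (diagFull_apply Θ₂ z₁ w).symm

end Transfer

/-! ### Assembling the factorization -/

section Factorization

variable {n : ℕ}

/-- A product of block diagonal operators that preserve the orthogonal complements of the spaces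
`N ⊗ E` may be compressed factor by factor. -/
theorem compress_product {D D₁ D₀ D₂ F F₁ F₀ F₂ E₁ E₂ E : Type*}
    [NormedAddCommGroup D] [InnerProductSpace ℂ D] [CompleteSpace D]
    [NormedAddCommGroup D₁] [InnerProductSpace ℂ D₁] [CompleteSpace D₁]
    [NormedAddCommGroup D₀] [InnerProductSpace ℂ D₀] [CompleteSpace D₀]
    [NormedAddCommGroup D₂] [InnerProductSpace ℂ D₂] [CompleteSpace D₂]
    [NormedAddCommGroup F] [InnerProductSpace ℂ F] [CompleteSpace F]
    [NormedAddCommGroup F₁] [InnerProductSpace ℂ F₁] [CompleteSpace F₁]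
    [NormedAddCommGroup F₀] [InnerProductSpace ℂ F₀] [CompleteSpace F₀]
    [NormedAddCommGroup F₂] [InnerProductSpace ℂ F₂] [CompleteSpace F₂]
    [NormedAddCommGroup E₁] [InnerProductSpace ℂ E₁] [CompleteSpace E₁]
    [NormedAddCommGroup E₂] [InnerProductSpace ℂ E₂] [CompleteSpace E₂]
    [NormedAddCommGroup E] [InnerProductSpace ℂ E] [CompleteSpace E]
    {N : Submodule ℂ (Fock n)} {Θ : FockTensor n D →L[ℂ] FockTensor n F}
    {Θ₁ : FockTensor n D₁ →L[ℂ] FockTensor n F₁} {Θ₀ : FockTensor n D₀ →L[ℂ] FockTensor n F₀}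
    {Θ₂ : FockTensor n D₂ →L[ℂ] FockTensor n F₂} (h₁ : PreservesOrthogonal N Θ₁)
    (h₀ : PreservesOrthogonal N Θ₀) (h₂ : PreservesOrthogonal N Θ₂)
    (τ₁ : WithLp 2 (F₀ × E) →L[ℂ] WithLp 2 (D₂ × E₁))
    (τ₂ : WithLp 2 (F₁ × E₂) →L[ℂ] WithLp 2 (D₀ × E)) (W : D →L[ℂ] WithLp 2 (D₁ × E₂))
    (Ws : F →L[ℂ] WithLp 2 (F₂ × E₁))
    (h : idTensor Ws ∘L Θ = (diagFull Θ₂ E₁ ∘L idTensor τ₁ ∘L diagFull Θ₀ E ∘L idTensor τ₂ ∘L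
      diagFull Θ₁ E₂) ∘L idTensor W) :
    idTensorOn N Ws ∘L compress N Θ =
      (diagId (compress N Θ₂) E₁ ∘L idTensorOn N τ₁ ∘L diagId (compress N Θ₀) E ∘L
        idTensorOn N τ₂ ∘L diagId (compress N Θ₁) E₂) ∘L idTensorOn N W := by
  have p₁ : PreservesOrthogonal N (diagFull Θ₁ E₂) := h₁.diagFull
  have p₀ : PreservesOrthogonal N (diagFull Θ₀ E) := h₀.diagFull
  have p₂ : PreservesOrthogonal N (diagFull Θ₂ E₁) := h₂.diagFull
  have q₁ := idTensor_preservesOrthogonal N τ₁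
  have q₂ := idTensor_preservesOrthogonal N τ₂
  simp only [diagId_compress h₁, diagId_compress h₀, diagId_compress h₂, ← compress_idTensor]
  rw [← compress_comp (idTensor_preservesOrthogonal N Ws), h,
    compress_comp (p₂.comp (q₁.comp (p₀.comp (q₂.comp p₁)))), compress_comp p₂, compress_comp q₁,
    compress_comp p₀, compress_comp q₂]

theorem Colligation.norm_stateMap_le {H E K F : Type*}
    [NormedAddCommGroup H] [InnerProductSpace ℂ H] [NormedAddCommGroup E] [InnerProductSpace ℂ E]
    [NormedAddCommGroup K] [InnerProductSpace ℂ K] [NormedAddCommGroup F] [InnerProductSpace ℂ F]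
    (U : Colligation H E K F) : ‖U.stateMap‖ ≤ 1 := by
  refine ContinuousLinearMap.opNorm_le_bound _ zero_le_one fun h => ?_
  rw [one_mul]
  refine le_of_sq_le_sq ?_ (norm_nonneg _)
  have := U.norm_stateMap_outMap h
  nlinarith [sq_nonneg ‖U.outMap h‖]

/-- A minimal colligation with block triangular state map is unitarily equivalent to a cascade of
minimal colligations of the diagonal entries. -/
theorem exists_cascade_unitary {H₁ H₂ K₁ K₂ D D₁ D₂ F F₁ F₂ : Type*}
    [NormedAddCommGroup H₁] [InnerProductSpace ℂ H₁] [CompleteSpace H₁]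
    [NormedAddCommGroup H₂] [InnerProductSpace ℂ H₂] [CompleteSpace H₂]
    [NormedAddCommGroup K₁] [InnerProductSpace ℂ K₁] [CompleteSpace K₁]
    [NormedAddCommGroup K₂] [InnerProductSpace ℂ K₂] [CompleteSpace K₂]
    [NormedAddCommGroup D] [InnerProductSpace ℂ D] [CompleteSpace D]
    [NormedAddCommGroup D₁] [InnerProductSpace ℂ D₁] [CompleteSpace D₁]
    [NormedAddCommGroup D₂] [InnerProductSpace ℂ D₂] [CompleteSpace D₂]
    [NormedAddCommGroup F] [InnerProductSpace ℂ F] [CompleteSpace F]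
    [NormedAddCommGroup F₁] [InnerProductSpace ℂ F₁] [CompleteSpace F₁]
    [NormedAddCommGroup F₂] [InnerProductSpace ℂ F₂] [CompleteSpace F₂]
    {V : Colligation (WithLp 2 (H₁ × H₂)) D (WithLp 2 (K₁ × K₂)) F} {U₁ : Colligation H₁ D₁ K₁ F₁}
    {U₂ : Colligation H₂ D₂ K₂ F₂} (hV : V.IsMinimal) (h₁ : U₁.IsMinimal) (h₂ : U₂.IsMinimal)
    (hM₁ : ∀ x y, (V.stateMap (WithLp.toLp 2 (x, y))).fst = U₁.stateMap x)
    (hM₂ : ∀ y, (V.stateMap (WithLp.toLp 2 (0, y))).snd = U₂.stateMap y) :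
    ∃ (B : D₂ →L[ℂ] F₁) (hB : ‖B‖ ≤ 1) (W : D ≃ₗᵢ[ℂ] WithLp 2 (D₁ × defectSpace B))
      (Ws : F ≃ₗᵢ[ℂ] WithLp 2 (F₂ × defectSpace (ContinuousLinearMap.adjoint B))),
      ∀ x e, cascade U₁ U₂ (julia B hB) (WithLp.toLp 2 (x, W e)) =
        WithLp.toLp 2 ((V (WithLp.toLp 2 (x, e))).fst, Ws (V (WithLp.toLp 2 (x, e))).snd) := by
  obtain ⟨B, hB, hB'⟩ := exists_cascade h₁ h₂ V.stateMap V.norm_stateMap_le hM₁ hM₂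
  exact ⟨B, hB, hV.exists_unitary (cascade_isMinimal h₁ h₂ (julia_isMinimal B hB))
    (fun x => (hB' x).symm)⟩

/-- A contraction with block triangular matrix has a minimal colligation that is a cascade of
minimal colligations of the diagonal entries. -/
theorem exists_isMinimal_cascade {H₁ H₂ K₁ K₂ D₁ D₂ F₁ F₂ : Type*}
    [NormedAddCommGroup H₁] [InnerProductSpace ℂ H₁] [CompleteSpace H₁]
    [NormedAddCommGroup H₂] [InnerProductSpace ℂ H₂] [CompleteSpace H₂]
    [NormedAddCommGroup K₁] [InnerProductSpace ℂ K₁] [CompleteSpace K₁]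
    [NormedAddCommGroup K₂] [InnerProductSpace ℂ K₂] [CompleteSpace K₂]
    [NormedAddCommGroup D₁] [InnerProductSpace ℂ D₁] [CompleteSpace D₁]
    [NormedAddCommGroup D₂] [InnerProductSpace ℂ D₂] [CompleteSpace D₂]
    [NormedAddCommGroup F₁] [InnerProductSpace ℂ F₁] [CompleteSpace F₁]
    [NormedAddCommGroup F₂] [InnerProductSpace ℂ F₂] [CompleteSpace F₂]
    {U₁ : Colligation H₁ D₁ K₁ F₁} {U₂ : Colligation H₂ D₂ K₂ F₂}
    (h₁ : U₁.IsMinimal) (h₂ : U₂.IsMinimal)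
    (M : WithLp 2 (H₁ × H₂) →L[ℂ] WithLp 2 (K₁ × K₂)) (hM : ‖M‖ ≤ 1)
    (hM₁ : ∀ x y, (M (WithLp.toLp 2 (x, y))).fst = U₁.stateMap x)
    (hM₂ : ∀ y, (M (WithLp.toLp 2 (0, y))).snd = U₂.stateMap y) :
    ∃ (A : D₂ →L[ℂ] F₁) (hA : ‖A‖ ≤ 1), (cascade U₁ U₂ (julia A hA)).IsMinimal ∧
      ∀ x, (cascade U₁ U₂ (julia A hA)).stateMap x = M x := by
  obtain ⟨A, hA, hA'⟩ := exists_cascade h₁ h₂ M hM hM₁ hM₂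
  exact ⟨A, hA, cascade_isMinimal h₁ h₂ (julia_isMinimal A hA), hA'⟩

/-- A minimal colligation with block triangular state map of size three is unitarily equivalent to
an iterated cascade of minimal colligations of the diagonal entries. -/
theorem exists_cascade_three {H₁ H₀ H₂ K₁ K₀ K₂ D D₁ D₀ D₂ F F₁ F₀ F₂ : Type*}
    [NormedAddCommGroup H₁] [InnerProductSpace ℂ H₁] [CompleteSpace H₁]
    [NormedAddCommGroup H₀] [InnerProductSpace ℂ H₀] [CompleteSpace H₀]
    [NormedAddCommGroup H₂] [InnerProductSpace ℂ H₂] [CompleteSpace H₂]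
    [NormedAddCommGroup K₁] [InnerProductSpace ℂ K₁] [CompleteSpace K₁]
    [NormedAddCommGroup K₀] [InnerProductSpace ℂ K₀] [CompleteSpace K₀]
    [NormedAddCommGroup K₂] [InnerProductSpace ℂ K₂] [CompleteSpace K₂]
    [NormedAddCommGroup D] [InnerProductSpace ℂ D] [CompleteSpace D]
    [NormedAddCommGroup D₁] [InnerProductSpace ℂ D₁] [CompleteSpace D₁]
    [NormedAddCommGroup D₀] [InnerProductSpace ℂ D₀] [CompleteSpace D₀]
    [NormedAddCommGroup D₂] [InnerProductSpace ℂ D₂] [CompleteSpace D₂]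
    [NormedAddCommGroup F] [InnerProductSpace ℂ F] [CompleteSpace F]
    [NormedAddCommGroup F₁] [InnerProductSpace ℂ F₁] [CompleteSpace F₁]
    [NormedAddCommGroup F₀] [InnerProductSpace ℂ F₀] [CompleteSpace F₀]
    [NormedAddCommGroup F₂] [InnerProductSpace ℂ F₂] [CompleteSpace F₂]
    {V : Colligation (Sum3 H₁ H₀ H₂) D (Sum3 K₁ K₀ K₂) F} {U₁ : Colligation H₁ D₁ K₁ F₁}
    {U₀ : Colligation H₀ D₀ K₀ F₀} {U₂ : Colligation H₂ D₂ K₂ F₂}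
    (hV : V.IsMinimal) (h₁ : U₁.IsMinimal) (h₀ : U₀.IsMinimal) (h₂ : U₂.IsMinimal)
    (hM₁ : ∀ x y, (V.stateMap (WithLp.toLp 2 (x, y))).fst = U₁.stateMap x)
    (hM₀ : ∀ x y, (V.stateMap (WithLp.toLp 2 (0, WithLp.toLp 2 (x, y)))).snd.fst = U₀.stateMap x)
    (hM₂ : ∀ y, (V.stateMap (WithLp.toLp 2 (0, WithLp.toLp 2 (0, y)))).snd.snd = U₂.stateMap y) :
    ∃ (A : D₂ →L[ℂ] F₀) (hA : ‖A‖ ≤ 1) (B : WithLp 2 (D₀ × defectSpace A) →L[ℂ] F₁) (hB : ‖B‖ ≤ 1)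
      (W : D ≃ₗᵢ[ℂ] WithLp 2 (D₁ × defectSpace B))
      (Ws : F ≃ₗᵢ[ℂ] WithLp 2 (WithLp 2 (F₂ × defectSpace (ContinuousLinearMap.adjoint A)) ×
          defectSpace (ContinuousLinearMap.adjoint B))),
      ∀ x e, cascade U₁ (cascade U₀ U₂ (julia A hA)) (julia B hB) (WithLp.toLp 2 (x, W e)) =
        WithLp.toLp 2 ((V (WithLp.toLp 2 (x, e))).fst, Ws (V (WithLp.toLp 2 (x, e))).snd) := by
  have hM : ‖V.stateMap‖ ≤ 1 := V.norm_stateMap_le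
  have hM' : ‖WithLp.sndL 2 ℂ K₁ (WithLp 2 (K₀ × K₂)) ∘L V.stateMap ∘L
      inrL H₁ (WithLp 2 (H₀ × H₂))‖ ≤ 1 := by
    refine ContinuousLinearMap.opNorm_le_bound _ zero_le_one fun x => ?_
    refine (WithLp.norm_snd_le ..).trans ((V.stateMap.le_of_opNorm_le hM _).trans_eq ?_)
    congr 1
    exact WithLp.norm_toLp_snd ..
  -- The lower right two-by-two corner is realized first. The resulting minimal cascade then serves
  -- as the second colligation in a cascade with `U₁`.
  obtain ⟨A, hA, hU, hA'⟩ := exists_isMinimal_cascade h₀ h₂ _ hM' hM₀ hM₂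
  exact ⟨A, hA, exists_cascade_unitary hV h₁ hU hM₁ fun y => (hA' y).symm⟩

theorem Colligation.IsMinimal.trans_state {H D K K' F : Type*}
    [NormedAddCommGroup H] [InnerProductSpace ℂ H] [NormedAddCommGroup D] [InnerProductSpace ℂ D]
    [NormedAddCommGroup K] [InnerProductSpace ℂ K] [NormedAddCommGroup K'] [InnerProductSpace ℂ K']
    [NormedAddCommGroup F] [InnerProductSpace ℂ F] {V : Colligation H D K F} (hV : V.IsMinimal)
    (ρ : K ≃ₗᵢ[ℂ] K') :
    Colligation.IsMinimal (H := H) (K := K') (V.trans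
      (LinearIsometryEquiv.withLpProdCongr 2 ρ (LinearIsometryEquiv.refl ℂ F))) := by
  refine ⟨fun e he => hV.input e (ρ.injective (he.trans (map_zero _).symm)), fun f hf =>
    hV.output f ?_⟩
  have h : (V.symm (WithLp.toLp 2 (ρ.symm 0, f))).fst = 0 := hf
  rwa [map_zero] at h

/-- The compressed transfer operator of a minimal colligation with block triangular state map is a
product of those of minimal colligations of the diagonal entries. -/
theorem IsTransfer.exists_compress_factorization {H₁ H₀ H₂ D F D₁ D₀ D₂ F₁ F₀ F₂ : Type u}
    [NormedAddCommGroup H₁] [InnerProductSpace ℂ H₁] [CompleteSpace H₁]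
    [NormedAddCommGroup H₀] [InnerProductSpace ℂ H₀] [CompleteSpace H₀]
    [NormedAddCommGroup H₂] [InnerProductSpace ℂ H₂] [CompleteSpace H₂]
    [NormedAddCommGroup D] [InnerProductSpace ℂ D] [CompleteSpace D]
    [NormedAddCommGroup F] [InnerProductSpace ℂ F] [CompleteSpace F]
    [NormedAddCommGroup D₁] [InnerProductSpace ℂ D₁] [CompleteSpace D₁]
    [NormedAddCommGroup D₀] [InnerProductSpace ℂ D₀] [CompleteSpace D₀]
    [NormedAddCommGroup D₂] [InnerProductSpace ℂ D₂] [CompleteSpace D₂]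
    [NormedAddCommGroup F₁] [InnerProductSpace ℂ F₁] [CompleteSpace F₁]
    [NormedAddCommGroup F₀] [InnerProductSpace ℂ F₀] [CompleteSpace F₀]
    [NormedAddCommGroup F₂] [InnerProductSpace ℂ F₂] [CompleteSpace F₂]
    {V : Colligation (Sum3 H₁ H₀ H₂) D (PiLp 2 fun _ : Fin n => Sum3 H₁ H₀ H₂) F}
    {U₁ : Colligation H₁ D₁ (PiLp 2 fun _ : Fin n => H₁) F₁}
    {U₀ : Colligation H₀ D₀ (PiLp 2 fun _ : Fin n => H₀) F₀}
    {U₂ : Colligation H₂ D₂ (PiLp 2 fun _ : Fin n => H₂) F₂}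
    {Θ : FockTensor n D →L[ℂ] FockTensor n F} {Θ₁ : FockTensor n D₁ →L[ℂ] FockTensor n F₁}
    {Θ₀ : FockTensor n D₀ →L[ℂ] FockTensor n F₀} {Θ₂ : FockTensor n D₂ →L[ℂ] FockTensor n F₂}
    (hV : IsTransfer V Θ) (h₁ : IsTransfer U₁ Θ₁) (h₀ : IsTransfer U₀ Θ₀) (h₂ : IsTransfer U₂ Θ₂)
    (mV : V.IsMinimal) (m₁ : U₁.IsMinimal) (m₀ : U₀.IsMinimal) (m₂ : U₂.IsMinimal)
    (hM₁ : ∀ x y, (splitRow n H₁ H₀ H₂ (V.stateMap (WithLp.toLp 2 (x, y)))).fst = U₁.stateMap x)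
    (hM₀ : ∀ x y, (splitRow n H₁ H₀ H₂
      (V.stateMap (WithLp.toLp 2 (0, WithLp.toLp 2 (x, y))))).snd.fst = U₀.stateMap x)
    (hM₂ : ∀ y, (splitRow n H₁ H₀ H₂
      (V.stateMap (WithLp.toLp 2 (0, WithLp.toLp 2 (0, y))))).snd.snd = U₂.stateMap y)
    {N : Submodule ℂ (Fock n)} (p₁ : PreservesOrthogonal N Θ₁) (p₀ : PreservesOrthogonal N Θ₀)
    (p₂ : PreservesOrthogonal N Θ₂) :
    ∃ (E₁ : Type u) (_ : NormedAddCommGroup E₁) (_ : InnerProductSpace ℂ E₁)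
      (_ : CompleteSpace E₁)
      (E₂ : Type u) (_ : NormedAddCommGroup E₂) (_ : InnerProductSpace ℂ E₂)
      (_ : CompleteSpace E₂)
      (E : Type u) (_ : NormedAddCommGroup E) (_ : InnerProductSpace ℂ E)
      (_ : CompleteSpace E)
      (τ₁ : WithLp 2 (F₀ × E) ≃ₗᵢ[ℂ] WithLp 2 (D₂ × E₁))
      (τ₂ : WithLp 2 (F₁ × E₂) ≃ₗᵢ[ℂ] WithLp 2 (D₀ × E)),
      Coincides (compress N Θ)
        (diagId (compress N Θ₂) E₁ ∘L
          idTensorOn N (τ₁ : WithLp 2 (F₀ × E) →L[ℂ] WithLp 2 (D₂ × E₁)) ∘L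
          diagId (compress N Θ₀) E ∘L
          idTensorOn N (τ₂ : WithLp 2 (F₁ × E₂) →L[ℂ] WithLp 2 (D₀ × E)) ∘L
          diagId (compress N Θ₁) E₂) := by
  obtain ⟨A, hA, B, hB, W, Ws, hW⟩ := exists_cascade_three (mV.trans_state (splitRow n H₁ H₀ H₂))
    m₁ m₀ m₂ hM₁ hM₀ hM₂
  -- `B` maps `D₀ ⊕ 𝒟_A` to `F₁`, so its Julia unitary goes from `F₁ ⊕ 𝒟_B` to `(D₀ ⊕ 𝒟_A) ⊕
  -- 𝒟_{B*}`. Rebracketing yields `E₂ = 𝒟_B` and `E = 𝒟_A ⊕ 𝒟_{B*}`.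
  let τ₂ := (julia B hB).trans (LinearIsometryEquiv.withLpProdAssoc 2 ℂ D₀ (defectSpace A)
    (defectSpace (ContinuousLinearMap.adjoint B)))
  -- The Julia unitary of `A` acts on `F₀ ⊕ 𝒟_A`, while the extra output `𝒟_{B*}` of the first
  -- connection is carried along unchanged; hence `E₁ = 𝒟_{A*} ⊕ 𝒟_{B*}`.
  let τ₁ := (LinearIsometryEquiv.withLpProdAssoc 2 ℂ F₀ (defectSpace A)
      (defectSpace (ContinuousLinearMap.adjoint B))).symm.trans
    ((LinearIsometryEquiv.withLpProdCongr 2 (julia A hA) (LinearIsometryEquiv.refl ℂ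
      (defectSpace (ContinuousLinearMap.adjoint B)))).trans
      (LinearIsometryEquiv.withLpProdAssoc 2 ℂ D₂ (defectSpace (ContinuousLinearMap.adjoint A))
        (defectSpace (ContinuousLinearMap.adjoint B))))
  exact ⟨WithLp 2 (defectSpace (ContinuousLinearMap.adjoint A) ×
      defectSpace (ContinuousLinearMap.adjoint B)), inferInstance, inferInstance, inferInstance,
    defectSpace B, inferInstance, inferInstance, inferInstance,
    WithLp 2 (defectSpace A × defectSpace (ContinuousLinearMap.adjoint B)), inferInstance,
    inferInstance, inferInstance, τ₁, τ₂, W,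
    Ws.trans (LinearIsometryEquiv.withLpProdAssoc 2 ℂ _ _ _), compress_product p₁ p₀ p₂ _ _ _ _
      (hV.eq_of_cascade h₁ h₀ h₂ (julia A hA) (julia B hB) W Ws τ₁ (fun _ _ _ => rfl) τ₂
        (fun _ => rfl) hW)⟩

end Factorization

end NCVariety

end

set_option maxHeartbeats 800000 in
theorem mainTheorem7 {n : ℕ} (P : Set (FreeAlgebra ℂ (Fin n)))
    (hJ : (wotIdeal P : Set (Fock n →L[ℂ] Fock n)) ≠ toeplitzAlg n)
    {H₁ H₀ H₂ : Type u}
    [NormedAddCommGroup H₁] [InnerProductSpace ℂ H₁] [CompleteSpace H₁]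
    [NormedAddCommGroup H₀] [InnerProductSpace ℂ H₀] [CompleteSpace H₀]
    [NormedAddCommGroup H₂] [InnerProductSpace ℂ H₂] [CompleteSpace H₂]
    (T : Fin n → Sum3 H₁ H₀ H₂ →L[ℂ] Sum3 H₁ H₀ H₂)
    (S : Fin n → H₁ →L[ℂ] H₁) (N : Fin n → H₀ →L[ℂ] H₀) (C : Fin n → H₂ →L[ℂ] H₂)
    (X : Fin n → H₀ →L[ℂ] H₁) (Y : Fin n → H₂ →L[ℂ] H₁) (Z : Fin n → H₂ →L[ℂ] H₀)
    (hT : ∀ i, IsUpperTriangular (T i) (S i) (X i) (Y i) (N i) (Z i) (C i))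
    (hTJ : IsConstrained P T) :
    (IsConstrained P S ∧ IsConstrained P N ∧ IsConstrained P C) ∧
    ∃ (E₁ : Type u) (_ : NormedAddCommGroup E₁) (_ : InnerProductSpace ℂ E₁)
      (_ : CompleteSpace E₁)
      (E₂ : Type u) (_ : NormedAddCommGroup E₂) (_ : InnerProductSpace ℂ E₂)
      (_ : CompleteSpace E₂)
      (E : Type u) (_ : NormedAddCommGroup E) (_ : InnerProductSpace ℂ E)
      (_ : CompleteSpace E)
      (τ₁ : WithLp 2 (DStarSpace N × E) ≃ₗᵢ[ℂ] WithLp 2 (DSpace C × E₁))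
      (τ₂ : WithLp 2 (DStarSpace S × E₂) ≃ₗᵢ[ℂ] WithLp 2 (DSpace N × E)),
      Coincides (constrCharFun P T)
        (diagId (constrCharFun P C) E₁ ∘L
          idTensorOn (subspaceN P)
            (τ₁ : WithLp 2 (DStarSpace N × E) →L[ℂ] WithLp 2 (DSpace C × E₁)) ∘L
          diagId (constrCharFun P N) E ∘L
          idTensorOn (subspaceN P)
            (τ₂ : WithLp 2 (DStarSpace S × E₂) →L[ℂ] WithLp 2 (DSpace N × E)) ∘L
          diagId (constrCharFun P S) E₂) := by
  obtain ⟨hc, hp⟩ := hTJ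
  obtain ⟨hS, hN, hC⟩ := IsUpperTriangular.isRowContraction hT hc
  have hpoly := fun p hpP => IsUpperTriangular.evalPoly_eq_zero hT (hp p hpP)
  refine ⟨⟨⟨hS, fun p h => (hpoly p h).1⟩, ⟨hN, fun p h => (hpoly p h).2.1⟩,
    ⟨hC, fun p h => (hpoly p h).2.2⟩⟩, ?_⟩
  change ‖rowOp T‖ ≤ 1 at hc
  change ‖rowOp S‖ ≤ 1 at hS
  change ‖rowOp N‖ ≤ 1 at hN
  change ‖rowOp C‖ ≤ 1 at hC
  have pR := rightCreation_mem_subspaceN_orthogonal P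
  -- `constrCharFun` is by definition the compression of `charFun` to `𝒩`, so the general
  -- factorization applies. The remaining goals identify the diagonal of `T*`.
  refine IsTransfer.exists_compress_factorization (charFun_isTransfer T hc)
    (charFun_isTransfer S hS) (charFun_isTransfer N hN) (charFun_isTransfer C hC)
    (julia_isMinimal _ hc) (julia_isMinimal _ hS) (julia_isMinimal _ hN) (julia_isMinimal _ hC)
    (fun x y => ?_) (fun x y => ?_) (fun y => ?_)
    (charFun_preservesOrthogonal pR S hS) (charFun_preservesOrthogonal pR N hN)
    (charFun_preservesOrthogonal pR C hC)
  · rw [julia_stateMap, julia_stateMap]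
    exact splitAdjoint_fst hT x y
  · rw [julia_stateMap, julia_stateMap]
    exact splitAdjoint_snd_fst hT x y
  · rw [julia_stateMap, julia_stateMap]
    exact splitAdjoint_snd_snd hT y
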